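/- Let $C$ be an abelian von Neumann algebra (acting on a Hilbert space $H$), with spectrum (character space) $\Delta$. A central $C$-bimodule is a $C$-module $X$ regarded as a bimodule with $xc=cx$. A central Banach $C$-bimodule $X$ is \emph{representable} ($X\in \mathrm{CRM}_C$) if there are Hilbert spaces $K,L$, unital $*$-representations $\pi:C\to B(K)$, $\sigma:C\to B(L)$ and a linear isometry $\Phi:X\to B(L,K)$ with $\Phi(cx)=\pi(c)\Phi(x)$ and $\Phi(xc)=\Phi(x)\sigma(c)$ for all $c\in C$, $x\in X$; it is \emph{normal representable} ($X\in\mathrm{CNRM}_C$) if $\pi$ and $\sigma$ can in addition be chosen normal. For Banach spaces, $\stackrel{\gamma}{\otimes}$ is the Banach space projective tensor product; for Banach $C$-modules $X,Y$, $X\stackrel{\gamma}{\otimes}_C Y$ is the quotient of $X\stackrel{\gamma}{\otimes}Y$ by the closed linear span of all $xc\otimes y-x\otimes cy$ ($x\in X$, $y\in Y$, $c\in C$). (1) For $X,Y\in\mathrm{CNRM}_C$ the representable $C$-bimodule $X\stackrel{\gamma}{\otimes}_C Y$ need not be normal. Precisely: infinite-dimensional abelian von Neumann algebras exist, and for each infinite-dimensional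 abelian von Neumann algebra $C$ there are $X,Y\in\mathrm{CNRM}_C$ such that $X\stackrel{\gamma}{\otimes}_C Y\in\mathrm{CRM}_C$ but $X\stackrel{\gamma}{\otimes}_C Y\notin\mathrm{CNRM}_C$. (2) Explicitly: there are Banach spaces $U$, $V$ and a closed subspace $U_0\subseteq U$ such that the canonical contraction $U_0\stackrel{\gamma}{\otimes}V\to U\stackrel{\gamma}{\otimes}V$ is not isometric. For any such $U_0\subseteq U$ and $V$, any abelian von Neumann algebra $C$ with spectrum $\Delta$, and any non-isolated point $t_0\in\Delta$, put $$X=\{f\in C(\Delta,U):\ f(t_0)\in U_0\},\qquad Y=C(\Delta,V),$$ with the supremum norms and the $C$-action $(cf)(t)=t(c)f(t)$. Then $X,Y\in\mathrm{CNRM}_C$ and $X\stackrel{\gamma}{\otimes}_C Y\in\mathrm{CRM}_C$, but $X\stackrel{\gamma}{\otimes}_C Y\notin\mathrm{CNRM}_C$. -/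

import Mathlib

open scoped TensorProduct
open WeakDual UniformSpace

universe u v w

/-! ### Abelian von Neumann algebras as commutative C*-algebras -/

namespace VonNeumannAlgebra

variable {H : Type u} [NormedAddCommGroup H] [InnerProductSpace ℂ H] [CompleteSpace H]

instance instSMulMemClass : SMulMemClass (VonNeumannAlgebra H) ℂ (H →L[ℂ] H) where
  smul_mem {M} c _ hx := M.toStarSubalgebra.smul_mem hx c

instance instIsClosed (M : VonNeumannAlgebra H) : IsClosed (M : Set (H →L[ℂ] H)) := by
  rw [← M.centralizer_centralizer]
  exact Set.isClosed_centralizer _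

/-- A commutative von Neumann algebra, with the operations and the operator norm inherited from
`B(H)`, is a commutative C*-algebra. -/
noncomputable instance instCommCStarAlgebra (M : VonNeumannAlgebra H) [IsMulCommutative M] :
    CommCStarAlgebra M where
  toCompleteSpace := (instIsClosed M).completeSpace_coe
  norm_mul_self_le x := CStarRing.norm_star_mul_self (x := (x : H →L[ℂ] H)) |>.symm.le
  mul_comm := (IsMulCommutative.is_comm (M := M)).comm

end VonNeumannAlgebra

namespace CentralModule

/-! ### Central representable and central normal representable bimodules -/

section Representable

variable (C : Type u) [CommCStarAlgebra C]

/-- A unital *-representation of `C` on a Hilbert space is normal if it preserves suprema of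
(bounded) increasing nets of self-adjoint elements. Here `C` carries its usual order and the
bounded operators carry the Loewner order. -/
def IsNormalRep {C : Type u} [CommCStarAlgebra C] [PartialOrder C]
    {K : Type w} [NormedAddCommGroup K] [InnerProductSpace ℂ K] [CompleteSpace K]
    (π : C →⋆ₐ[ℂ] (K →L[ℂ] K)) : Prop :=
  ∀ (S : Set C) (a : C), S.Nonempty → DirectedOn (· ≤ ·) S → (∀ s ∈ S, IsSelfAdjoint s) →
    IsLUB S a → IsLUB (π '' S) (π a)

variable (X : Type v) [NormedAddCommGroup X] [NormedSpace ℂ X] [Module C X]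

/-- `X` is a central representable Banach bimodule over the commutative C*-algebra `C`.

A central bimodule (`c x = x c`) is the same thing as a `C`-module, regarded as a bimodule with
right action `x c = c x`. Representability: there are Hilbert spaces `K`, `L` with
*-representations `π`, `σ` of `C` and an isometric linear map `Φ : X → B(L, K)` that is a
bimodule map, `Φ (c x) = π(c) Φ(x)` and `Φ (x c) = Φ(x) σ(c)`. -/
def IsCRM : Prop :=
  CompleteSpace X ∧
  ∃ (K : Type (max u v)) (_ : NormedAddCommGroup K) (_ : InnerProductSpace ℂ K)
    (_ : CompleteSpace K)
    (L : Type (max u v)) (_ : NormedAddCommGroup L) (_ : InnerProductSpace ℂ L)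
    (_ : CompleteSpace L)
    (π : C →⋆ₐ[ℂ] (K →L[ℂ] K)) (σ : C →⋆ₐ[ℂ] (L →L[ℂ] L)) (Φ : X →ₗᵢ[ℂ] (L →L[ℂ] K)),
    ∀ (c : C) (x : X), Φ (c • x) = π c ∘L Φ x ∧ Φ (c • x) = Φ x ∘L σ c

/-- `X` is a central normal representable Banach bimodule over the abelian von Neumann algebra
`C`: as in `IsCRM`, but with both representations normal. -/
def IsCNRM [PartialOrder C] : Prop :=
  CompleteSpace X ∧
  ∃ (K : Type (max u v)) (_ : NormedAddCommGroup K) (_ : InnerProductSpace ℂ K)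
    (_ : CompleteSpace K)
    (L : Type (max u v)) (_ : NormedAddCommGroup L) (_ : InnerProductSpace ℂ L)
    (_ : CompleteSpace L)
    (π : C →⋆ₐ[ℂ] (K →L[ℂ] K)) (σ : C →⋆ₐ[ℂ] (L →L[ℂ] L)) (Φ : X →ₗᵢ[ℂ] (L →L[ℂ] K)),
    IsNormalRep π ∧ IsNormalRep σ ∧
    ∀ (c : C) (x : X), Φ (c • x) = π c ∘L Φ x ∧ Φ (c • x) = Φ x ∘L σ c

end Representable

/-! ### The projective tensor product of Banach spaces -/

section Projective

variable (X : Type v) [NormedAddCommGroup X] [NormedSpace ℂ X]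
variable (Y : Type w) [NormedAddCommGroup Y] [NormedSpace ℂ Y]

/-- The algebraic tensor product of two normed spaces, to be given the projective norm. -/
def AlgTensor : Type (max v w) := X ⊗[ℂ] Y

noncomputable instance : AddCommGroup (AlgTensor X Y) := inferInstanceAs (AddCommGroup (X ⊗[ℂ] Y))
noncomputable instance : Module ℂ (AlgTensor X Y) := inferInstanceAs (Module ℂ (X ⊗[ℂ] Y))

variable {X Y}

/-- The elementary tensor `x ⊗ y`. -/
def AlgTensor.tmul (x : X) (y : Y) : AlgTensor X Y := x ⊗ₜ[ℂ] y

/-- The set of all sums `∑ⱼ ‖xⱼ‖ ‖yⱼ‖` over the representations `w = ∑ⱼ xⱼ ⊗ yⱼ`. -/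
def AlgTensor.costs (w : AlgTensor X Y) : Set ℝ :=
  {r | ∃ (n : ℕ) (x : Fin n → X) (y : Fin n → Y),
    w = ∑ j, AlgTensor.tmul (x j) (y j) ∧ r = ∑ j, ‖x j‖ * ‖y j‖}

/-- The projective norm `γ(w) = inf { ∑ⱼ ‖xⱼ‖ ‖yⱼ‖ : w = ∑ⱼ xⱼ ⊗ yⱼ }`. -/
noncomputable instance : Norm (AlgTensor X Y) := ⟨fun w => sInf w.costs⟩

namespace AlgTensor

lemma norm_def (w : AlgTensor X Y) : ‖w‖ = sInf w.costs := rfl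

lemma costs_nonneg {w : AlgTensor X Y} {r : ℝ} (hr : r ∈ w.costs) : 0 ≤ r := by
  obtain ⟨n, x, y, -, rfl⟩ := hr
  positivity

lemma costs_bddBelow (w : AlgTensor X Y) : BddBelow w.costs := ⟨0, fun _ => costs_nonneg⟩

lemma tmul_mem_costs (x : X) (y : Y) : ‖x‖ * ‖y‖ ∈ (tmul x y).costs :=
  ⟨1, fun _ => x, fun _ => y, by simp, by simp⟩

lemma zero_mem_costs : (0 : ℝ) ∈ (0 : AlgTensor X Y).costs :=
  ⟨0, Fin.elim0, Fin.elim0, by simp, by simp⟩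

lemma add_mem_costs {w z : AlgTensor X Y} {r s : ℝ} (hr : r ∈ w.costs) (hs : s ∈ z.costs) :
    r + s ∈ (w + z).costs := by
  obtain ⟨n, x, y, rfl, rfl⟩ := hr
  obtain ⟨m, x', y', rfl, rfl⟩ := hs
  exact ⟨n + m, Fin.append x x', Fin.append y y', by simp [Fin.sum_univ_add],
    by simp [Fin.sum_univ_add]⟩

lemma costs_nonempty (w : AlgTensor X Y) : w.costs.Nonempty := by
  induction w using TensorProduct.induction_on with
  | zero => exact ⟨0, zero_mem_costs⟩
  | tmul x y => exact ⟨_, tmul_mem_costs x y⟩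
  | add w z hw hz =>
    obtain ⟨r, hr⟩ := hw
    obtain ⟨s, hs⟩ := hz
    exact ⟨r + s, add_mem_costs hr hs⟩

lemma norm_le_of_mem {w : AlgTensor X Y} {r : ℝ} (hr : r ∈ w.costs) : ‖w‖ ≤ r :=
  csInf_le (costs_bddBelow w) hr

lemma exists_lt {w : AlgTensor X Y} {b : ℝ} (h : ‖w‖ < b) : ∃ r ∈ w.costs, r < b :=
  exists_lt_of_csInf_lt (costs_nonempty w) h

lemma alg_norm_nonneg (w : AlgTensor X Y) : 0 ≤ ‖w‖ :=
  Real.sInf_nonneg fun _ => costs_nonneg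

lemma norm_add_le' (w z : AlgTensor X Y) : ‖w + z‖ ≤ ‖w‖ + ‖z‖ := by
  refine le_of_forall_pos_lt_add fun ε hε => ?_
  obtain ⟨r, hr, hr'⟩ := exists_lt (show ‖w‖ < ‖w‖ + ε / 2 by linarith)
  obtain ⟨s, hs, hs'⟩ := exists_lt (show ‖z‖ < ‖z‖ + ε / 2 by linarith)
  have := norm_le_of_mem (add_mem_costs hr hs)
  linarith

/-- A map between algebraic tensor products that multiplies costs by at most `k` multiplies the
projective norm by at most `k`. -/
lemma norm_map_le {X' : Type*} [NormedAddCommGroup X'] [NormedSpace ℂ X']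
    {Y' : Type*} [NormedAddCommGroup Y'] [NormedSpace ℂ Y']
    (T : AlgTensor X Y →+ AlgTensor X' Y') (f : X → X') (g : Y → Y') {k : ℝ} (hk : 0 ≤ k)
    (hT : ∀ x y, T (tmul x y) = tmul (f x) (g y)) (hfg : ∀ x y, ‖f x‖ * ‖g y‖ ≤ k * (‖x‖ * ‖y‖))
    (w : AlgTensor X Y) : ‖T w‖ ≤ k * ‖w‖ := by
  have key : ∀ r ∈ w.costs, ‖T w‖ ≤ k * r := by
    rintro r ⟨n, x, y, rfl, rfl⟩
    refine (norm_le_of_mem ⟨n, fun j => f (x j), fun j => g (y j), by simp [hT], rfl⟩).trans ?_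
    rw [Finset.mul_sum]
    exact Finset.sum_le_sum fun j _ => hfg _ _
  refine le_of_forall_pos_le_add fun ε hε => ?_
  obtain ⟨r, hr, hr'⟩ := exists_lt (show ‖w‖ < ‖w‖ + ε / (k + 1) by
    have : 0 < ε / (k + 1) := by positivity
    linarith)
  have h1 : k * (ε / (k + 1)) ≤ ε := by
    rw [mul_div_assoc', div_le_iff₀ (by positivity)]
    nlinarith
  calc ‖T w‖ ≤ k * r := key r hr
    _ ≤ k * (‖w‖ + ε / (k + 1)) := mul_le_mul_of_nonneg_left hr'.le hk
    _ ≤ k * ‖w‖ + ε := by rw [mul_add]; linarith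

lemma norm_smul_le' (a : ℂ) (w : AlgTensor X Y) : ‖a • w‖ ≤ ‖a‖ * ‖w‖ :=
  norm_map_le (DistribSMul.toAddMonoidHom (AlgTensor X Y) a) (fun x => a • x) id (norm_nonneg a)
    (fun x y => (TensorProduct.smul_tmul' (R := ℂ) a x y))
    (fun x y => by simp [norm_smul, mul_assoc]) w

/-- The projective norm as a seminorm. -/
noncomputable def projectiveSeminorm : Seminorm ℂ (AlgTensor X Y) :=
  .ofSMulLE norm
    (le_antisymm (norm_le_of_mem zero_mem_costs) (alg_norm_nonneg _)) norm_add_le' norm_smul_le'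

end AlgTensor

noncomputable instance : SeminormedAddCommGroup (AlgTensor X Y) :=
  AddGroupSeminorm.toSeminormedAddCommGroup AlgTensor.projectiveSeminorm.toAddGroupSeminorm

noncomputable instance : NormedSpace ℂ (AlgTensor X Y) := ⟨AlgTensor.norm_smul_le'⟩

variable (X Y)

/-- The Banach space projective tensor product of `X` and `Y`: the completion of the algebraic
tensor product in the projective norm. -/
abbrev ProjTensor : Type (max v w) := Completion (AlgTensor X Y)

variable {X}

/-- For a subspace `X₀ ⊆ X`, the canonical contraction `X₀ ⊗ Y → X ⊗ Y` between algebraic tensor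
products with their projective norms. -/
noncomputable def AlgTensor.inclusion (X₀ : Submodule ℂ X) :
    AlgTensor X₀ Y →L[ℂ] AlgTensor X Y :=
  LinearMap.mkContinuous
    (show AlgTensor X₀ Y →ₗ[ℂ] AlgTensor X Y from
      (TensorProduct.map X₀.subtype (LinearMap.id : Y →ₗ[ℂ] Y) : X₀ ⊗[ℂ] Y →ₗ[ℂ] X ⊗[ℂ] Y)) 1
    (AlgTensor.norm_map_le
      (LinearMap.toAddMonoidHom (show AlgTensor X₀ Y →ₗ[ℂ] AlgTensor X Y from
        (TensorProduct.map X₀.subtype (LinearMap.id : Y →ₗ[ℂ] Y) :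
          X₀ ⊗[ℂ] Y →ₗ[ℂ] X ⊗[ℂ] Y)))
      X₀.subtype id zero_le_one
      (fun x y => TensorProduct.map_tmul X₀.subtype (LinearMap.id : Y →ₗ[ℂ] Y) x y)
      (fun x y => by simp))

/-- For a subspace `X₀ ⊆ X`, the canonical contraction `X₀ ⊗^γ Y → X ⊗^γ Y` between Banach space
projective tensor products. -/
noncomputable def ProjTensor.inclusion (X₀ : Submodule ℂ X) :
    ProjTensor X₀ Y →L[ℂ] ProjTensor X Y :=
  (AlgTensor.inclusion Y X₀).completion

end Projective

/-! ### The projective tensor product of Banach modules -/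

section ModuleProjective

section LeftAction

variable {C : Type u} [CommCStarAlgebra C]
variable {X : Type v} [NormedAddCommGroup X] [NormedSpace ℂ X] [Module C X] [IsScalarTower ℂ C X]
variable {Y : Type w} [NormedAddCommGroup Y] [NormedSpace ℂ Y]

/-- `C` acts on the tensor product through the first factor: `c (x ⊗ y) = (c x) ⊗ y`. -/
noncomputable instance : Module C (AlgTensor X Y) :=
  inferInstanceAs (Module C (X ⊗[ℂ] Y))

instance : IsScalarTower ℂ C (AlgTensor X Y) :=
  inferInstanceAs (IsScalarTower ℂ C (X ⊗[ℂ] Y))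

lemma AlgTensor.smul_tmul' (c : C) (x : X) (y : Y) :
    c • AlgTensor.tmul x y = AlgTensor.tmul (c • x) y :=
  TensorProduct.smul_tmul' (R := ℂ) c x y

instance [IsBoundedSMul C X] : IsBoundedSMul C (AlgTensor X Y) :=
  .of_norm_smul_le fun c w =>
    AlgTensor.norm_map_le (DistribSMul.toAddMonoidHom (AlgTensor X Y) c) (fun x => c • x) id
      (norm_nonneg c) (fun x y => AlgTensor.smul_tmul' c x y)
      (fun x y => by
        rw [← mul_assoc]
        exact mul_le_mul_of_nonneg_right (norm_smul_le c x) (norm_nonneg y)) w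

end LeftAction

variable (C : Type u) [CommCStarAlgebra C]
variable (X : Type v) [NormedAddCommGroup X] [NormedSpace ℂ X]
  [Module C X] [IsScalarTower ℂ C X] [IsBoundedSMul C X]
variable (Y : Type w) [NormedAddCommGroup Y] [NormedSpace ℂ Y]
  [Module C Y] [IsScalarTower ℂ C Y] [IsBoundedSMul C Y]


/-- The elements `x c ⊗ y - x ⊗ c y` of the Banach space projective tensor product. -/
def balancingSet : Set (ProjTensor X Y) :=
  {z | ∃ (x : X) (c : C) (y : Y),
    z = ((AlgTensor.tmul (c • x) y - AlgTensor.tmul x (c • y) : AlgTensor X Y) : ProjTensor X Y)}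

lemma smul_mem_balancingSet (d : C) {z : ProjTensor X Y} (hz : z ∈ balancingSet C X Y) :
    d • z ∈ balancingSet C X Y := by
  obtain ⟨x, c, y, rfl⟩ := hz
  refine ⟨d • x, c, y, ?_⟩
  rw [← Completion.coe_smul, smul_sub, AlgTensor.smul_tmul', AlgTensor.smul_tmul', smul_comm d c x]

/-- The linear span of the elements `x c ⊗ y - x ⊗ c y`; it is a `C`-submodule. -/
noncomputable def balancingSpan : Submodule C (ProjTensor X Y) where
  carrier := Submodule.span ℂ (balancingSet C X Y)
  add_mem' := Submodule.add_mem _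
  zero_mem' := Submodule.zero_mem _
  smul_mem' d z hz := by
    have hz' : z ∈ Submodule.span ℂ (balancingSet C X Y) := hz
    show d • z ∈ Submodule.span ℂ (balancingSet C X Y)
    induction hz' using Submodule.span_induction with
    | mem b hb => exact Submodule.subset_span (smul_mem_balancingSet C X Y d hb)
    | zero => rw [smul_zero]; exact Submodule.zero_mem _
    | add a b ha hb iha ihb => rw [smul_add]; exact Submodule.add_mem _ (iha ha) (ihb hb)
    | smul t a ha iha => rw [smul_comm]; exact Submodule.smul_mem _ t (iha ha)

/-- The closed linear span of the elements `x c ⊗ y - x ⊗ c y`. -/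
noncomputable def balancingSubmodule : Submodule C (ProjTensor X Y) :=
  (balancingSpan C X Y).topologicalClosure

instance : IsClosed (balancingSubmodule C X Y : Set (ProjTensor X Y)) :=
  Submodule.isClosed_topologicalClosure _

/-- The projective tensor product of Banach `C`-modules: the quotient of the Banach space
projective tensor product by the closed subspace generated by the elements `x c ⊗ y - x ⊗ c y`,
with the quotient norm and with the `C`-action induced by `c (x ⊗ y) = (c x) ⊗ y`. -/
abbrev ModTensor : Type (max v w) := ProjTensor X Y ⧸ balancingSubmodule C X Y

end ModuleProjective

/-! ### Modules of continuous vector-valued functions on the spectrum -/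

section Functions

variable (C : Type u) [CommCStarAlgebra C]
variable (U : Type v) [NormedAddCommGroup U] [NormedSpace ℂ U]

/-- The Banach space `C(Δ, U)` of continuous `U`-valued functions on the spectrum `Δ` of `C`, with
the supremum norm. -/
def VecFun : Type (max u v) := C(characterSpace ℂ C, U)

noncomputable instance : NormedAddCommGroup (VecFun C U) :=
  inferInstanceAs (NormedAddCommGroup C(characterSpace ℂ C, U))

noncomputable instance : NormedSpace ℂ (VecFun C U) :=
  inferInstanceAs (NormedSpace ℂ C(characterSpace ℂ C, U))

instance : FunLike (VecFun C U) (characterSpace ℂ C) U :=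
  inferInstanceAs (FunLike C(characterSpace ℂ C, U) (characterSpace ℂ C) U)

/-- `C` acts on `C(Δ, U)` by multiplication with Gelfand transforms: `(c f)(t) = t(c) f(t)`. -/
noncomputable instance : Module C (VecFun C U) :=
  letI : Module C(characterSpace ℂ C, ℂ) (VecFun C U) :=
    inferInstanceAs (Module C(characterSpace ℂ C, ℂ) C(characterSpace ℂ C, U))
  Module.compHom (VecFun C U) (gelfandTransform ℂ C : C →ₐ[ℂ] C(characterSpace ℂ C, ℂ)).toRingHom

variable {C U}

lemma VecFun.smul_apply (c : C) (f : VecFun C U) (t : characterSpace ℂ C) :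
    (c • f) t = t c • f t := rfl

lemma VecFun.complex_smul_apply (a : ℂ) (f : VecFun C U) (t : characterSpace ℂ C) :
    (a • f) t = a • f t := rfl

instance : IsScalarTower ℂ C (VecFun C U) :=
  ⟨fun a c f => ContinuousMap.ext fun t => by
    change ((a • c) • f) t = (a • c • f) t
    simp [VecFun.smul_apply, VecFun.complex_smul_apply, mul_smul]⟩

instance : IsBoundedSMul C (VecFun C U) :=
  .of_norm_smul_le fun c f => by
    refine (ContinuousMap.norm_le (α := characterSpace ℂ C) (E := U) _ (by positivity)).2
      fun t => ?_
    have h1 : ‖t c‖ ≤ ‖c‖ :=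
      (ContinuousMap.norm_coe_le_norm (gelfandTransform ℂ C c) t).trans
        ((gelfandTransform_isometry C).norm_map_of_map_zero (map_zero _) c).le
    calc ‖t c • f t‖ = ‖t c‖ * ‖f t‖ := norm_smul _ _
      _ ≤ ‖c‖ * ‖f‖ := mul_le_mul h1
          (ContinuousMap.norm_coe_le_norm (α := characterSpace ℂ C) (E := U) f t)
          (norm_nonneg _) (norm_nonneg _)

/-- The `C`-submodule `{f ∈ C(Δ, U) : f(t₀) ∈ U₀}` of `C(Δ, U)`. -/
def pinnedFun (t₀ : characterSpace ℂ C) (U₀ : Submodule ℂ U) : Submodule C (VecFun C U) where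
  carrier := {f | f t₀ ∈ U₀}
  add_mem' hf hg := U₀.add_mem hf hg
  zero_mem' := U₀.zero_mem
  smul_mem' c _ hf := U₀.smul_mem (t₀ c) hf

instance (S : Submodule C (VecFun C U)) : IsBoundedSMul C S :=
  .of_norm_smul_le fun c f => norm_smul_le c (f : VecFun C U)

end Functions

end CentralModule

/-! Normality forces a semicontinuity of the norm: if an increasing net of elements `c` has supremum
`1`, then `‖z‖` is at most any common bound of the norms `‖c • z‖` (`IsCNRM.norm_le`). The tensor
product of pinned functions with `C(Δ, V)` violates this. At a non-isolated `t₀` the positive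
contractions vanishing at `t₀` have supremum `1` (`isLUB_vanishingContractions`). Regard `w ∈ U₀ ⊗
V` as a tensor of constant functions. Evaluation at `t₀` shows that its norm over `C` is at least
the norm of `w` in `U₀ ⊗ V` (`le_norm_constTensor`). Once multiplied by some `c` with `t₀ c = 0`,
constants from all of `U` become admissible in the first factor, so the norm drops to at most that
of `w` in `U ⊗ V` (`norm_smul_constTensor_le`). Normality would thus make the inclusion isometric.

The factors themselves are normal: `f ↦ φ ∘ f`, with `φ` in the dual unit ball, maps `C(Δ, U)` into
`C(Δ) = M ⊆ B(H)`, and the sum of these maps is isometric over a multiple of the identity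
representation.

Representability of the tensor product rests on the inequality `‖aφ‖ + ‖(1 - a)φ‖ ≤ ‖φ‖` for
functionals and `0 ≤ a ≤ 1`. Given it, an extreme norming functional is an eigenvector of every
multiplication, hence lives over a character, and one-dimensional representations suffice
(`isCRM_of_split`). The inequality says that `a (x ⊗ y) + (1 - a) (x' ⊗ y')` stays in the unit ball.
For a projection `a` this is the single tensor `(a x + (1 - a) x') ⊗ (a y + (1 - a) y')`. A general
`a` is a mean of `n` near-projections whose total defect is bounded independently of `n`; then `n →
∞` (`norm_convex_modTmul_le`). -/

namespace CentralModule

/-! ### Monotone nets of operators and weak operator limits -/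

section WeakLimit

variable {K : Type*} [NormedAddCommGroup K] [InnerProductSpace ℂ K] [CompleteSpace K]

omit [CompleteSpace K] in
lemma re_inner_le_of_le {s t : K →L[ℂ] K} (h : s ≤ t) (x : K) :
    (inner ℂ (s x) x).re ≤ (inner ℂ (t x) x).re := by
  have := ((ContinuousLinearMap.le_def s t).1 h).re_inner_nonneg_left x
  simp only [sub_apply, inner_sub_left, map_sub] at this
  exact sub_nonneg.1 this

/-- A bounded family of operators has a weak operator limit along every ultrafilter. -/
lemma exists_weak_limit {ι : Type*} (F : Ultrafilter ι) (T : ι → K →L[ℂ] K) {B : ℝ}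
    (hB : ∀ᶠ i in F, ‖T i‖ ≤ B) :
    ∃ W : K →L[ℂ] K, ∀ x y : K, Filter.Tendsto (fun i => inner ℂ (T i x) y) F
      (nhds (inner ℂ (W x) y)) := by
  have hB0 : 0 ≤ B := by
    obtain ⟨i, hi⟩ := hB.exists
    exact (norm_nonneg _).trans hi
  have hbound : ∀ x y : K, ∀ᶠ i in F, ‖inner ℂ (T i x) y‖ ≤ B * ‖x‖ * ‖y‖ := fun x y => by
    filter_upwards [hB] with i hi
    exact (norm_inner_le_norm _ _).trans
      (mul_le_mul_of_nonneg_right ((T i).le_of_opNorm_le hi x) (norm_nonneg y))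
  have hex : ∀ x y : K, ∃ l : ℂ, ‖l‖ ≤ B * ‖x‖ * ‖y‖ ∧
      Filter.Tendsto (fun i => inner ℂ (T i x) y) F (nhds l) := fun x y => by
    have hc := isCompact_closedBall (0 : ℂ) (B * ‖x‖ * ‖y‖)
    obtain ⟨l, hl, hl'⟩ := hc.ultrafilter_le_nhds' (F.map fun i => inner ℂ (T i x) y)
      (Ultrafilter.mem_map.2 ((hbound x y).mono fun i hi => by simpa using hi))
    exact ⟨l, by simpa using hl, hl'⟩
  choose l hl hlim using hex
  let L : K →ₗ⋆[ℂ] K →ₗ[ℂ] ℂ := LinearMap.mk₂'ₛₗ (starRingEnd ℂ) (RingHom.id ℂ) l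
    (fun x x' y => tendsto_nhds_unique (hlim _ _)
      (((hlim x y).add (hlim x' y)).congr fun i => by simp))
    (fun c x y => tendsto_nhds_unique (hlim _ _)
      (((hlim x y).const_mul (starRingEnd ℂ c)).congr fun i => by simp [mul_comm]))
    (fun x y y' => tendsto_nhds_unique (hlim _ _)
      (((hlim x y).add (hlim x y')).congr fun i => by simp))
    (fun c x y => tendsto_nhds_unique (hlim _ _)
      (((hlim x y).const_mul c).congr fun i => by simp))
  refine ⟨InnerProductSpace.continuousLinearMapOfBilin
    (L.mkContinuous₂ B fun x y => hl x y), fun x y => ?_⟩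
  rw [InnerProductSpace.continuousLinearMapOfBilin_apply]
  exact hlim x y

/-- The decreasing net `a - s`, `s ∈ S`, has an infimum `W`, which is a weak operator limit. -/
lemma exists_inf_of_directedOn {S : Set (K →L[ℂ] K)} {a : K →L[ℂ] K} (hne : S.Nonempty)
    (hdir : DirectedOn (· ≤ ·) S) (ha : a ∈ upperBounds S) :
    ∃ W : K →L[ℂ] K, 0 ≤ W ∧ (∀ s ∈ S, W ≤ a - s) ∧
      (∀ x : K, ∀ ε > 0, ∃ s ∈ S, (inner ℂ ((a - s) x) x).re ≤ (inner ℂ (W x) x).re + ε) ∧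
      ∀ y : K →L[ℂ] K, (∀ s ∈ S, y * (a - s) = (a - s) * y) → y * W = W * y := by
  have : Nonempty S := hne.to_subtype
  have : IsDirected S (· ≤ ·) := ⟨directedOn_iff_directed.1 hdir⟩
  -- An ultrafilter finer than the tails makes limits exist by compactness alone; monotonicity is
  -- used only to compare the limit with the members of the net.
  let F : Ultrafilter S := Ultrafilter.of Filter.atTop
  have hF : (F : Filter S) ≤ Filter.atTop := Ultrafilter.of_le _
  obtain ⟨s₀⟩ := ‹Nonempty S›
  have htail : ∀ s : S, ∀ᶠ t in F, s ≤ t := fun s => hF (Filter.eventually_ge_atTop s)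
  -- The net need only be bounded on a tail: `0 ≤ a - t ≤ a - s₀` for `t ≥ s₀`.
  obtain ⟨W, hW⟩ := exists_weak_limit F (fun s : S => a - (s : K →L[ℂ] K))
    (B := ‖a - (s₀ : K →L[ℂ] K)‖) (by
      filter_upwards [htail s₀] with t ht
      exact CStarAlgebra.norm_le_norm_of_nonneg_of_le (sub_nonneg.2 (ha t.2))
        (sub_le_sub_left (show (s₀ : K →L[ℂ] K) ≤ t from ht) a))
  have hre : ∀ x : K, Filter.Tendsto (fun s : S => (inner ℂ ((a - (s : K →L[ℂ] K)) x) x).re) F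
      (nhds (inner ℂ (W x) x).re) := fun x => (Complex.continuous_re.tendsto _).comp (hW x x)
  have him : ∀ x : K, (inner ℂ (W x) x).im = 0 := fun x => by
    refine tendsto_nhds_unique ((Complex.continuous_im.tendsto _).comp (hW x x)) ?_
    refine tendsto_const_nhds.congr fun s => ?_
    have := ((ContinuousLinearMap.isPositive_iff_complex _).1
      ((ContinuousLinearMap.le_def _ _).1 (ha s.2)) x).1
    exact congrArg Complex.im this
  have hpos : ∀ V : K →L[ℂ] K, (∀ x : K, (inner ℂ (V x) x).im = 0) →
      (∀ x, 0 ≤ (inner ℂ (V x) x).re) → V.IsPositive := fun V h1 h2 =>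
    (ContinuousLinearMap.isPositive_iff_complex _).2 fun x =>
      ⟨Complex.ext (by simp) (by simp [h1]), h2 x⟩
  refine ⟨W, ?_, fun s hs => ?_, fun x ε hε => ?_, fun y hy => ?_⟩
  · rw [ContinuousLinearMap.nonneg_iff_isPositive]
    refine hpos W him fun x => ge_of_tendsto' (hre x) fun s => ?_
    exact ((ContinuousLinearMap.le_def _ _).1 (ha s.2)).re_inner_nonneg_left x
  · rw [ContinuousLinearMap.le_def]
    refine hpos _ (fun x => ?_) fun x => ?_
    · have := ((ContinuousLinearMap.isPositive_iff_complex _).1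
        ((ContinuousLinearMap.le_def _ _).1 (ha hs)) x).1
      have := congrArg Complex.im this
      simp only [Complex.ofReal_im] at this
      rw [sub_apply, inner_sub_left, Complex.sub_im, him x, ← this]
      simp
    · rw [sub_apply, inner_sub_left, Complex.sub_re, sub_nonneg]
      refine le_of_tendsto (hre x) ?_
      filter_upwards [htail ⟨s, hs⟩] with t ht
      exact re_inner_le_of_le (sub_le_sub_left (show s ≤ (t : K →L[ℂ] K) from ht) a) x
  · obtain ⟨s, hs⟩ := ((hre x).eventually_lt_const (lt_add_of_pos_right _ hε)).exists
    exact ⟨s, s.2, hs.le⟩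
  · refine ContinuousLinearMap.ext fun x => ext_inner_right ℂ fun z => ?_
    refine tendsto_nhds_unique ?_ (hW (y x) z)
    have := hW x (ContinuousLinearMap.adjoint y z)
    rw [ContinuousLinearMap.adjoint_inner_right] at this
    refine this.congr fun s => ?_
    rw [ContinuousLinearMap.adjoint_inner_right]
    exact congrArg (fun T : K →L[ℂ] K => inner ℂ (T x) z) (hy s s.2)

/-- Suprema of increasing nets of operators are weak operator limits. -/
lemma exists_re_inner_sub_le_of_isLUB {S : Set (K →L[ℂ] K)} {a : K →L[ℂ] K} (hne : S.Nonempty)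
    (hdir : DirectedOn (· ≤ ·) S) (ha : IsLUB S a) (x : K) {ε : ℝ} (hε : 0 < ε) :
    ∃ s ∈ S, (inner ℂ ((a - s) x) x).re ≤ ε := by
  obtain ⟨W, hW0, hWs, hW, -⟩ := exists_inf_of_directedOn hne hdir ha.1
  -- Since `W ≤ a - s` for all `s`, the operator `a - W` is again an upper bound of `S`, so
  -- leastness of `a` forces `W = 0`.
  have h1 : a ≤ a - W := ha.2 fun s hs => by
    rw [le_sub_comm]; exact hWs s hs
  have h2 : W = 0 := le_antisymm (by simpa using h1) hW0
  obtain ⟨s, hs, h⟩ := hW x ε hε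
  exact ⟨s, hs, by simpa [h2] using h⟩

/-- A von Neumann algebra is closed under suprema of increasing nets: suprema computed in the
algebra are weak operator limits. -/
lemma exists_re_inner_sub_le_of_isLUB_vonNeumann (M : VonNeumannAlgebra K)
    {S : Set M} {a : M} (hne : S.Nonempty)
    (hdir : DirectedOn (· ≤ ·) S) (ha : IsLUB S a) (x : K) {ε : ℝ} (hε : 0 < ε) :
    ∃ s ∈ S, (inner ℂ (((a : K →L[ℂ] K) - s) x) x).re ≤ ε := by
  obtain ⟨W, hW0, hWs, hW, hWc⟩ := exists_inf_of_directedOn (S := Subtype.val '' S)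
    (a := (a : K →L[ℂ] K)) (hne.image _)
    (by
      rintro _ ⟨s, hs, rfl⟩ _ ⟨t, ht, rfl⟩
      obtain ⟨r, hr, h1, h2⟩ := hdir s hs t ht
      exact ⟨_, ⟨r, hr, rfl⟩, h1, h2⟩)
    (by rintro _ ⟨s, hs, rfl⟩; exact ha.1 hs)
  -- The weak limit commutes with the commutant, so the bicommutant property puts it in `M`, where
  -- `a` is known to be least.
  have hWM : W ∈ M := by
    rw [← M.commutant_commutant, VonNeumannAlgebra.mem_commutant_iff]
    intro y hy
    rw [VonNeumannAlgebra.mem_commutant_iff] at hy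
    refine hWc y ?_
    rintro _ ⟨s, hs, rfl⟩
    exact (hy _ (sub_mem a.2 s.2)).symm
  have h1 : a ≤ a - ⟨W, hWM⟩ := ha.2 fun s hs => by
    show (s : K →L[ℂ] K) ≤ (a : K →L[ℂ] K) - W
    rw [le_sub_comm]; exact hWs s ⟨s, hs, rfl⟩
  have h1' : (a : K →L[ℂ] K) ≤ (a : K →L[ℂ] K) - W := h1
  have h2 : W = 0 := le_antisymm (by simpa using h1') hW0
  obtain ⟨_, ⟨s, hs, rfl⟩, h⟩ := hW x ε hε
  exact ⟨s, hs, by simpa [h2] using h⟩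

end WeakLimit


/-! ### Direct sums of representations and of isometries -/

section DirectSum

/-- With `W = R* R` the hypothesis reads `‖R x‖² ≤ 0`. -/
lemma apply_eq_zero_of_re_inner_le {K : Type*} [NormedAddCommGroup K] [InnerProductSpace ℂ K]
    [CompleteSpace K] {W : K →L[ℂ] K} (hW : 0 ≤ W) {x : K} (hx : (inner ℂ (W x) x).re ≤ 0) :
    W x = 0 := by
  obtain ⟨R, rfl⟩ := (CStarAlgebra.nonneg_iff_eq_star_mul_self (a := W)).1 hW
  rw [mul_apply_eq_comp, ContinuousLinearMap.star_eq_adjoint,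
    ContinuousLinearMap.adjoint_inner_left] at hx
  have h : ‖R x‖ ^ 2 ≤ 0 := (inner_self_eq_norm_sq (𝕜 := ℂ) (R x)).symm.trans_le hx
  have h0 : R x = 0 := norm_eq_zero.1 (pow_eq_zero_iff two_ne_zero |>.1
    (le_antisymm h (sq_nonneg _)))
  rw [mul_apply_eq_comp, h0, map_zero]

variable {ι : Type*} {E : Type*} [NormedAddCommGroup E] [InnerProductSpace ℂ E]

/-- The diagonal operator on `⨁ E` with bounded diagonal entries. -/
noncomputable def diagOp (T : ι → E →L[ℂ] E) {B : ℝ} (hB : 0 ≤ B) (hT : ∀ i, ‖T i‖ ≤ B) :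
    lp (fun _ : ι => E) 2 →L[ℂ] lp (fun _ : ι => E) 2 :=
  lp.mapCLM 2 T hB hT

lemma diagOp_apply (T : ι → E →L[ℂ] E) {B : ℝ} (hB : 0 ≤ B) (hT : ∀ i, ‖T i‖ ≤ B)
    (x : lp (fun _ : ι => E) 2) (i : ι) : diagOp T hB hT x i = T i (x i) := rfl

lemma diagOp_single [DecidableEq ι] (T : ι → E →L[ℂ] E) {B : ℝ} (hB : 0 ≤ B)
    (hT : ∀ i, ‖T i‖ ≤ B) (i : ι) (e : E) :
    diagOp T hB hT (lp.single 2 i e) = lp.single 2 i (T i e) := by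
  refine lp.ext (funext fun j => ?_)
  rw [diagOp_apply]
  rcases eq_or_ne j i with rfl | h
  · simp
  · rw [lp.single_apply_ne _ _ _ h, lp.single_apply_ne _ _ _ h, map_zero]

lemma norm_diagOp_le (T : ι → E →L[ℂ] E) {B : ℝ} (hB : 0 ≤ B) (hT : ∀ i, ‖T i‖ ≤ B) :
    ‖diagOp T hB hT‖ ≤ B :=
  lp.norm_mapCLM_le 2 T hB hT

lemma le_norm_diagOp (T : ι → E →L[ℂ] E) {B : ℝ} (hB : 0 ≤ B) (hT : ∀ i, ‖T i‖ ≤ B) (i : ι) :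
    ‖T i‖ ≤ ‖diagOp T hB hT‖ := by
  classical
  refine ContinuousLinearMap.opNorm_le_bound _ (norm_nonneg (diagOp T hB hT)) fun e => ?_
  have := (diagOp T hB hT).le_opNorm (lp.single 2 i e)
  rwa [diagOp_single, lp.norm_single (by norm_num), lp.norm_single (by norm_num)] at this

variable [CompleteSpace E] {C : Type*} [CommCStarAlgebra C]

/-- The direct sum of a family of representations on the same Hilbert space. -/
noncomputable def sumRep (π : ι → C →⋆ₐ[ℂ] (E →L[ℂ] E)) :
    C →⋆ₐ[ℂ] (lp (fun _ : ι => E) 2 →L[ℂ] lp (fun _ : ι => E) 2) where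
  toFun c := diagOp (fun i => π i c) (norm_nonneg c)
    fun i => NonUnitalStarAlgHom.norm_apply_le (π i) c
  map_one' := by
    refine ContinuousLinearMap.ext fun x => lp.ext (funext fun i => ?_)
    simp [diagOp_apply]
  map_mul' c d := by
    refine ContinuousLinearMap.ext fun x => lp.ext (funext fun i => ?_)
    simp [diagOp_apply]
  map_zero' := by
    refine ContinuousLinearMap.ext fun x => lp.ext (funext fun i => ?_)
    simp [diagOp_apply]
  map_add' c d := by
    refine ContinuousLinearMap.ext fun x => lp.ext (funext fun i => ?_)
    simp [diagOp_apply]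
  commutes' r := by
    refine ContinuousLinearMap.ext fun x => lp.ext (funext fun i => ?_)
    simp [diagOp_apply, Algebra.algebraMap_eq_smul_one]
  map_star' c := by
    rw [ContinuousLinearMap.star_eq_adjoint, ContinuousLinearMap.eq_adjoint_iff]
    intro x y
    rw [lp.inner_eq_tsum, lp.inner_eq_tsum]
    refine tsum_congr fun i => ?_
    rw [diagOp_apply, diagOp_apply, map_star, ContinuousLinearMap.star_eq_adjoint,
      ContinuousLinearMap.adjoint_inner_left]

lemma sumRep_single [DecidableEq ι] (π : ι → C →⋆ₐ[ℂ] (E →L[ℂ] E)) (c : C) (i : ι) (e : E) :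
    sumRep π c (lp.single 2 i e) = lp.single 2 i (π i c e) :=
  diagOp_single (fun i => π i c) (norm_nonneg c)
    (fun i => NonUnitalStarAlgHom.norm_apply_le (π i) c) i e

open scoped ComplexOrder in
lemma sumRep_nonneg (π : ι → C →⋆ₐ[ℂ] (E →L[ℂ] E)) (c : C) (hc : ∀ i, 0 ≤ π i c) :
    0 ≤ sumRep π c := by
  have hc' := fun i => (ContinuousLinearMap.nonneg_iff_isPositive _).1 (hc i)
  rw [ContinuousLinearMap.nonneg_iff_isPositive, ContinuousLinearMap.isPositive_iff']
  refine ⟨?_, fun x => ?_⟩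
  · rw [ContinuousLinearMap.isSelfAdjoint_iff_isSymmetric]
    intro x y
    change inner ℂ (sumRep π c x) y = inner ℂ x (sumRep π c y)
    rw [lp.inner_eq_tsum, lp.inner_eq_tsum]
    exact tsum_congr fun i => (hc' i).isSymmetric (x i) (y i)
  · exact (lp.hasSum_inner (sumRep π c x) x).nonneg fun i => (hc' i).inner_nonneg_left (x i)

/-- A direct sum of representations is normal as soon as each summand maps suprema of increasing
nets to weak operator limits. -/
lemma isNormalRep_sumRep [PartialOrder C] (π : ι → C →⋆ₐ[ℂ] (E →L[ℂ] E))
    (hmono : ∀ c d : C, c ≤ d → ∀ i, π i c ≤ π i d)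
    (hπ : ∀ (S : Set C) (a : C), S.Nonempty → DirectedOn (· ≤ ·) S → IsLUB S a →
      ∀ (i : ι) (x : E), ∀ ε > 0, ∃ s ∈ S, (inner ℂ (π i (a - s) x) x).re ≤ ε) :
    IsNormalRep (sumRep π) := by
  classical
  intro S a hne hdir _ ha
  have hle : ∀ c d : C, c ≤ d → sumRep π c ≤ sumRep π d := fun c d h => by
    rw [← sub_nonneg, ← map_sub]
    exact sumRep_nonneg π _ fun i => by rw [map_sub, sub_nonneg]; exact hmono c d h i
  have hub : sumRep π a ∈ upperBounds (sumRep π '' S) := by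
    rintro _ ⟨s, hs, rfl⟩
    exact hle _ _ (ha.1 hs)
  refine ⟨hub, fun T hT => ?_⟩
  obtain ⟨W, hW0, hWs, hW, -⟩ := exists_inf_of_directedOn (hne.image (sumRep π))
    (by
      rintro _ ⟨s, hs, rfl⟩ _ ⟨t, ht, rfl⟩
      obtain ⟨r, hr, h1, h2⟩ := hdir s hs t ht
      exact ⟨_, ⟨r, hr, rfl⟩, hle _ _ h1, hle _ _ h2⟩) hub
  -- On a vector supported in one summand, `⟨W e, e⟩` is below the values for that summand, which
  -- are arbitrarily small. Such vectors determine `W`.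
  have hWzero : W = 0 := by
    refine lp.ext_continuousLinearMap (by norm_num) fun i => ContinuousLinearMap.ext fun e => ?_
    refine apply_eq_zero_of_re_inner_le hW0 (le_of_forall_pos_le_add fun ε hε => ?_)
    obtain ⟨s, hs, h⟩ := hπ S a hne hdir ha i e ε hε
    refine (re_inner_le_of_le (hWs _ ⟨s, hs, rfl⟩) _).trans ?_
    change (inner ℂ ((sumRep π a - sumRep π s) (lp.single 2 i e))
      (lp.single (E := fun _ : ι => E) 2 i e)).re ≤ 0 + ε
    rw [← map_sub, zero_add, sumRep_single, lp.inner_single_left, lp.single_apply_self]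
    exact h
  rw [← sub_nonneg, ContinuousLinearMap.nonneg_iff_isPositive,
    ContinuousLinearMap.isPositive_iff_complex]
  obtain ⟨s₀, hs₀⟩ := hne
  -- `T` itself need not be self-adjoint, but comparability with one member of the net makes the
  -- difference so.
  have hTa : IsSelfAdjoint (T - sumRep π a) := by
    have h1 : IsSelfAdjoint (T - sumRep π s₀) := (sub_nonneg.2 (hT ⟨s₀, hs₀, rfl⟩)).isSelfAdjoint
    have h2 : IsSelfAdjoint (sumRep π a - sumRep π s₀) :=
      (sub_nonneg.2 (hub ⟨s₀, hs₀, rfl⟩)).isSelfAdjoint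
    simpa using h1.sub h2
  intro x
  refine ⟨?_, ?_⟩
  · have := (ContinuousLinearMap.isSelfAdjoint_iff_isSymmetric.1 hTa).conj_inner_sym x x
    exact Complex.conj_eq_iff_re.1 this
  · refine le_of_forall_pos_le_add fun ε hε => ?_
    obtain ⟨_, ⟨s, hs, rfl⟩, h⟩ := hW x ε hε
    have h1 := re_inner_le_of_le (hT ⟨s, hs, rfl⟩) x
    simp only [hWzero, zero_apply, inner_zero_left, Complex.zero_re, zero_add,
      sub_apply, inner_sub_left, Complex.sub_re, RCLike.re_to_complex] at h ⊢
    linarith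

end DirectSum

section Criterion

variable {C : Type u} [CommCStarAlgebra C] {X : Type v} [NormedAddCommGroup X] [NormedSpace ℂ X]
  [Module C X]

/-- The direct sum of a norming family of linear maps into `B(E)`. -/
lemma exists_sum_isometry {ι : Type*} {E : Type*} [NormedAddCommGroup E] [InnerProductSpace ℂ E]
    [CompleteSpace E] (π : ι → C →⋆ₐ[ℂ] (E →L[ℂ] E)) (Φ : ι → X →ₗ[ℂ] (E →L[ℂ] E))
    (hΦ : ∀ i (c : C) x, Φ i (c • x) = π i c ∘L Φ i x ∧ Φ i (c • x) = Φ i x ∘L π i c)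
    (hle : ∀ i x, ‖Φ i x‖ ≤ ‖x‖) (hnorm : ∀ x, ∀ r < ‖x‖, 0 ≤ r → ∃ i, r ≤ ‖Φ i x‖) :
    ∃ Ψ : X →ₗᵢ[ℂ] (lp (fun _ : ι => E) 2 →L[ℂ] lp (fun _ : ι => E) 2),
      ∀ (c : C) (x : X), Ψ (c • x) = sumRep π c ∘L Ψ x ∧ Ψ (c • x) = Ψ x ∘L sumRep π c := by
  refine ⟨⟨⟨⟨fun x => diagOp (fun i => Φ i x) (norm_nonneg x) fun i => hle i x, fun x y => ?_⟩,
    fun c x => ?_⟩, fun x => ?_⟩, fun c x => ⟨?_, ?_⟩⟩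
  · refine ContinuousLinearMap.ext fun z => lp.ext (funext fun i => ?_)
    simp [diagOp_apply]
  · refine ContinuousLinearMap.ext fun z => lp.ext (funext fun i => ?_)
    simp [diagOp_apply]
  · refine le_antisymm (norm_diagOp_le _ (norm_nonneg x) fun i => hle i x) (le_of_forall_lt fun r hr => ?_)
    rcases lt_or_ge r 0 with h | h
    · exact h.trans_le (norm_nonneg _)
    · obtain ⟨r', h1, h2⟩ := exists_between hr
      obtain ⟨i, hi⟩ := hnorm x r' h2 (h.trans h1.le)
      exact (h1.trans_le hi).trans_le (le_norm_diagOp (fun i => Φ i x) (norm_nonneg x) (fun i => hle i x) i)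
  · refine ContinuousLinearMap.ext fun z => lp.ext (funext fun i => ?_)
    exact congrArg (fun T : E →L[ℂ] E => T (z i)) (hΦ i c x).1
  · refine ContinuousLinearMap.ext fun z => lp.ext (funext fun i => ?_)
    exact congrArg (fun T : E →L[ℂ] E => T (z i)) (hΦ i c x).2

end Criterion


/-! ### Gelfand transforms and normality of the function modules -/

section Gelfand

variable {C : Type u} [CommCStarAlgebra C]

/-- The element of `C` with a given Gelfand transform. -/
noncomputable def ofFun (h : C(characterSpace ℂ C, ℂ)) : C := (gelfandStarTransform C).symm h

lemma apply_ofFun (h : C(characterSpace ℂ C, ℂ)) (t : characterSpace ℂ C) : t (ofFun h) = h t :=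
  congrArg (fun f : C(characterSpace ℂ C, ℂ) => f t) ((gelfandStarTransform C).apply_symm_apply h)

lemma ext_char {a b : C} (h : ∀ t : characterSpace ℂ C, t a = t b) : a = b :=
  (gelfandStarTransform C).injective (ContinuousMap.ext h)

lemma norm_le_of_char {a : C} {r : ℝ} (hr : 0 ≤ r) (h : ∀ t : characterSpace ℂ C, ‖t a‖ ≤ r) :
    ‖a‖ ≤ r := by
  rw [← (gelfandTransform_isometry C).norm_map_of_map_zero (map_zero _) a]
  exact (ContinuousMap.norm_le _ hr).2 h

lemma norm_char_le (t : characterSpace ℂ C) (a : C) : ‖t a‖ ≤ ‖a‖ := by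
  rw [← (gelfandTransform_isometry C).norm_map_of_map_zero (map_zero _) a]
  exact ContinuousMap.norm_coe_le_norm (gelfandTransform ℂ C a) t

end Gelfand

namespace VecFun

variable {C : Type u} [CommCStarAlgebra C] {U : Type v} [NormedAddCommGroup U] [NormedSpace ℂ U]

omit [NormedSpace ℂ U] in
@[ext] lemma ext {f g : VecFun C U} (h : ∀ t, f t = g t) : f = g := ContinuousMap.ext h

omit [NormedSpace ℂ U] in
lemma norm_le {f : VecFun C U} {r : ℝ} (hr : 0 ≤ r) : ‖f‖ ≤ r ↔ ∀ t, ‖f t‖ ≤ r :=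
  ContinuousMap.norm_le (α := characterSpace ℂ C) (E := U) f hr

omit [NormedSpace ℂ U] in
lemma norm_apply_le (f : VecFun C U) (t : characterSpace ℂ C) : ‖f t‖ ≤ ‖f‖ :=
  ContinuousMap.norm_coe_le_norm (α := characterSpace ℂ C) (E := U) f t

omit [NormedSpace ℂ U] in
lemma add_apply (f g : VecFun C U) (t : characterSpace ℂ C) : (f + g) t = f t + g t := rfl

omit [NormedSpace ℂ U] in
lemma continuous_coe (f : VecFun C U) : Continuous f := ContinuousMap.continuous f

instance [CompleteSpace U] : CompleteSpace (VecFun C U) :=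
  inferInstanceAs (CompleteSpace C(characterSpace ℂ C, U))

lemma isClosed_pinnedFun (t₀ : characterSpace ℂ C) {U₀ : Submodule ℂ U}
    (hU₀ : IsClosed (U₀ : Set U)) : IsClosed (pinnedFun t₀ U₀ : Set (VecFun C U)) :=
  hU₀.preimage (continuous_eval_const (F := C(characterSpace ℂ C, U)) t₀)

end VecFun

section Normal

variable {H : Type u} [NormedAddCommGroup H] [InnerProductSpace ℂ H] [CompleteSpace H]
  (M : VonNeumannAlgebra H) [IsMulCommutative M]

/-- The identity representation of an abelian von Neumann algebra. -/
noncomputable def inclRep : M →⋆ₐ[ℂ] (H →L[ℂ] H) where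
  toFun := Subtype.val
  map_one' := rfl
  map_mul' _ _ := rfl
  map_zero' := rfl
  map_add' _ _ := rfl
  commutes' _ := rfl
  map_star' _ := rfl

variable {M} {U : Type v} [NormedAddCommGroup U] [NormedSpace ℂ U]

/-- The operator in `M` with Gelfand transform `φ ∘ f`. -/
noncomputable def funOp (φ : StrongDual ℂ U) (f : VecFun M U) : M :=
  ofFun ⟨fun t => φ (f t), φ.continuous.comp f.continuous_coe⟩

lemma apply_funOp (φ : StrongDual ℂ U) (f : VecFun M U) (t : characterSpace ℂ M) :
    t (funOp φ f) = φ (f t) := apply_ofFun _ t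

/-- A complete module that embeds isometrically into `C(Δ, U)` is normal representable. -/
lemma isCNRM_of_isometry {X : Type (max u v)} [NormedAddCommGroup X] [NormedSpace ℂ X]
    [Module M X] [CompleteSpace X] (J : X →ₗ[ℂ] VecFun M U) (hJ : ∀ x, ‖J x‖ = ‖x‖)
    (hJc : ∀ (c : M) x, J (c • x) = c • J x) : IsCNRM M X := by
  -- By Hahn–Banach the dual unit ball norms `U`, so these maps jointly recover the supremum norm.
  let ι := {φ : StrongDual ℂ U // ‖φ‖ ≤ 1}
  let Φ : ι → X →ₗ[ℂ] (H →L[ℂ] H) := fun φ =>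
    { toFun := fun x => (funOp φ.1 (J x) : M)
      map_add' := fun x y => congrArg Subtype.val (a₂ := funOp φ.1 (J x) + funOp φ.1 (J y))
        (ext_char fun t => by rw [map_add, map_add, apply_funOp, apply_funOp, apply_funOp,
          VecFun.add_apply, map_add])
      map_smul' := fun a x => congrArg Subtype.val (a₂ := a • funOp φ.1 (J x))
        (ext_char fun t => by rw [map_smul, map_smul, apply_funOp, apply_funOp,
          VecFun.complex_smul_apply, map_smul]) }
  have hmul : ∀ (φ : ι) (c : M) x, funOp φ.1 (J (c • x)) = c * funOp φ.1 (J x) := fun φ c x =>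
    ext_char fun t => by
      rw [map_mul, apply_funOp, apply_funOp, hJc, VecFun.smul_apply, map_smul, smul_eq_mul]
  obtain ⟨Ψ, hΨ⟩ := exists_sum_isometry (fun _ : ι => inclRep M) Φ
    (fun φ c x => ⟨congrArg Subtype.val (hmul φ c x),
      congrArg Subtype.val ((hmul φ c x).trans (mul_comm _ _))⟩)
    (fun φ x => by
      change ‖funOp φ.1 (J x)‖ ≤ ‖x‖
      refine norm_le_of_char (norm_nonneg x) fun t => ?_
      rw [apply_funOp]
      refine (φ.1.le_of_opNorm_le φ.2 _).trans ?_
      rw [one_mul, ← hJ x]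
      exact (J x).norm_apply_le t)
    (fun x r hr hr0 => by
      have : ∃ t, r < ‖J x t‖ := by
        by_contra! h
        exact absurd ((VecFun.norm_le hr0).2 h) (by rw [hJ]; exact not_le.2 hr)
      obtain ⟨t, ht⟩ := this
      obtain ⟨φ, hφ, hφt⟩ := exists_dual_vector'' ℂ (J x t)
      refine ⟨⟨φ, hφ⟩, ht.le.trans ?_⟩
      have h := norm_char_le t (funOp φ (J x))
      rw [apply_funOp, hφt, RCLike.norm_ofReal, abs_norm] at h
      exact h)
  have hnormal : IsNormalRep (sumRep fun _ : ι => inclRep M) :=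
    isNormalRep_sumRep _ (fun c d h _ => h) fun S a hne hdir ha _ x ε hε =>
      exists_re_inner_sub_le_of_isLUB_vonNeumann M hne hdir ha x hε
  exact ⟨inferInstance, _, _, _, inferInstance, _, _, _, inferInstance, _, _, Ψ, hnormal, hnormal,
    hΨ⟩

lemma isCNRM_vecFun [CompleteSpace U] : IsCNRM M (VecFun M U) :=
  isCNRM_of_isometry LinearMap.id (fun _ => rfl) fun _ _ => rfl

lemma isCNRM_pinnedFun [CompleteSpace U] (t₀ : characterSpace ℂ M) {U₀ : Submodule ℂ U}
    (hU₀ : IsClosed (U₀ : Set U)) : IsCNRM M (pinnedFun t₀ U₀) :=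
  haveI : CompleteSpace (pinnedFun t₀ U₀) :=
    (VecFun.isClosed_pinnedFun t₀ hU₀).completeSpace_coe
  isCNRM_of_isometry ((pinnedFun t₀ U₀).subtype.restrictScalars ℂ) (fun _ => rfl) fun _ _ => rfl

end Normal


/-! ### Representability from extreme norming functionals -/

section KreinMilman

/-- A norming functional that is extreme among the norming functionals in the dual unit ball. -/
lemma exists_extreme_norming {Z : Type v} [NormedAddCommGroup Z] [NormedSpace ℂ Z] (z : Z) :
    ∃ φ : StrongDual ℂ Z, ‖φ‖ ≤ 1 ∧ φ z = ‖z‖ ∧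
      ∀ φ₁ φ₂ : StrongDual ℂ Z, ‖φ₁‖ ≤ 1 → ‖φ₂‖ ≤ 1 → φ₁ z = ‖z‖ → φ₂ z = ‖z‖ →
        ∀ α β : ℝ, 0 < α → 0 < β → α + β = 1 → φ = (α : ℂ) • φ₁ + (β : ℂ) • φ₂ → φ₁ = φ := by
  let A : Set (WeakDual ℂ Z) := (WeakDual.toStrongDual ⁻¹' Metric.closedBall 0 1) ∩
    (fun φ : WeakDual ℂ Z => φ z) ⁻¹' {(‖z‖ : ℂ)}
  have hA : IsCompact A := (WeakDual.isCompact_closedBall 0 1).inter_right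
    (isClosed_singleton.preimage (WeakDual.eval_continuous z))
  -- Krein–Milman is applied to the image of this weak-* compact convex set in the product space;
  -- extremality is therefore relative to norming functionals only.
  let K : Set (Z → ℂ) := (fun φ : WeakDual ℂ Z => (φ : Z → ℂ)) '' A
  have hK : IsCompact K := hA.image (WeakDual.coeFn_continuous)
  have hmem : ∀ φ : StrongDual ℂ Z, ‖φ‖ ≤ 1 → φ z = ‖z‖ → (φ : Z → ℂ) ∈ K := fun φ h1 h2 =>
    ⟨StrongDual.toWeakDual φ, ⟨by simpa using h1, h2⟩, rfl⟩
  have hne : K.Nonempty := by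
    obtain ⟨φ, h1, h2⟩ := exists_dual_vector'' ℂ z
    exact ⟨_, hmem φ h1 h2⟩
  obtain ⟨f, hf⟩ := hK.extremePoints_nonempty hne
  obtain ⟨⟨φ, ⟨h1, h2⟩, rfl⟩, hext⟩ := mem_extremePoints.1 hf
  refine ⟨WeakDual.toStrongDual φ, by simpa using h1, h2,
    fun φ₁ φ₂ hφ₁ hφ₂ hz₁ hz₂ α β hα hβ hαβ h => ?_⟩
  refine DFunLike.coe_injective (hext _ (hmem φ₁ hφ₁ hz₁) _ (hmem φ₂ hφ₂ hz₂)
    ⟨α, β, hα, hβ, hαβ, ?_⟩).1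
  funext y
  exact (congrArg (fun ψ : StrongDual ℂ Z => ψ y) h).symm

variable {C : Type u} [CommCStarAlgebra C] {Z : Type v} [NormedAddCommGroup Z] [NormedSpace ℂ Z]
  [Module C Z] [IsScalarTower ℂ C Z] [IsBoundedSMul C Z]

/-- The functional `z ↦ φ (c z)`. -/
noncomputable def smulDual (c : C) (φ : StrongDual ℂ Z) : StrongDual ℂ Z :=
  LinearMap.mkContinuous
    { toFun := fun z => φ (c • z)
      map_add' := fun x y => by rw [smul_add, map_add]
      map_smul' := fun a x => by rw [smul_comm, map_smul, RingHom.id_apply] }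
    (‖φ‖ * ‖c‖) fun z => by
      rw [mul_assoc]
      exact (φ.le_opNorm _).trans (mul_le_mul_of_nonneg_left (norm_smul_le c z) (norm_nonneg φ))

lemma smulDual_apply (c : C) (φ : StrongDual ℂ Z) (z : Z) : smulDual c φ z = φ (c • z) := rfl

/-- `a` is a positive contraction: its Gelfand transform takes values in `[0, 1]`. -/
def IsPosContraction (a : C) : Prop :=
  ∀ t : characterSpace ℂ C, ∃ r : ℝ, 0 ≤ r ∧ r ≤ 1 ∧ t a = r

/-- Positive contractions span `C`: split into real and imaginary parts, and move a real element
with values in `[-R, R]` into `[0, 1]` by `(b + R) / (2R)`. -/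
lemma mem_of_isPosContraction_mem {P : Submodule ℂ C} (hP : ∀ a, IsPosContraction a → a ∈ P)
    (c : C) : c ∈ P := by
  have hone : (1 : C) ∈ P := hP 1 fun t => ⟨1, zero_le_one, le_rfl, by simp⟩
  have hreal : ∀ (b : C) (R : ℝ), 0 < R → (∀ t : characterSpace ℂ C, ∃ r : ℝ, |r| ≤ R ∧ t b = r) →
      b ∈ P := fun b R hR hb => by
    have h1 : ((2 * R : ℝ) : ℂ)⁻¹ • (b + (R : ℂ) • 1) ∈ P := hP _ fun t => by
      obtain ⟨r, hr, htr⟩ := hb t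
      obtain ⟨h1, h2⟩ := abs_le.1 hr
      refine ⟨(2 * R)⁻¹ * (r + R), by have : 0 ≤ r + R := by linarith
                                      positivity, ?_, ?_⟩
      · rw [inv_mul_le_one₀ (by positivity)]; linarith
      · rw [map_smul, map_add, map_smul, map_one, htr]; simp
    have h2 : b = ((2 * R : ℝ) : ℂ) • ((2 * R : ℝ) : ℂ)⁻¹ • (b + (R : ℂ) • (1 : C)) -
        (R : ℂ) • (1 : C) := by
      rw [smul_inv_smul₀ (by exact_mod_cast (by positivity : 2 * R ≠ 0)), add_sub_cancel_right]
    rw [h2]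
    exact P.sub_mem (P.smul_mem _ h1) (P.smul_mem _ hone)
  let re : C := ofFun ⟨fun t => ((t c).re : ℂ), Complex.continuous_ofReal.comp
    (Complex.continuous_re.comp (gelfandTransform ℂ C c).continuous)⟩
  let im : C := ofFun ⟨fun t => ((t c).im : ℂ), Complex.continuous_ofReal.comp
    (Complex.continuous_im.comp (gelfandTransform ℂ C c).continuous)⟩
  have hc : c = re + Complex.I • im := ext_char fun t => by
    rw [map_add, map_smul, apply_ofFun, apply_ofFun, smul_eq_mul, mul_comm]
    exact (Complex.re_add_im _).symm
  have hpos : 0 < ‖c‖ + 1 := by positivity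
  rw [hc]
  refine P.add_mem (hreal _ (‖c‖ + 1) hpos fun t => ⟨(t c).re, ?_, apply_ofFun _ t⟩)
    (P.smul_mem _ (hreal _ (‖c‖ + 1) hpos fun t => ⟨(t c).im, ?_, apply_ofFun _ t⟩))
  · exact ((Complex.abs_re_le_norm _).trans (norm_char_le t c)).trans (by linarith)
  · exact ((Complex.abs_im_le_norm _).trans (norm_char_le t c)).trans (by linarith)

/-- An extreme norming functional is supported at a point of the spectrum, provided that the dual
norm is additive over decompositions of the unit of `C`. -/
lemma exists_character_norming
    (hsplit : ∀ (φ : StrongDual ℂ Z) (a : C), IsPosContraction a →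
      ‖smulDual a φ‖ + ‖smulDual (1 - a) φ‖ ≤ ‖φ‖) {z : Z} (hz : z ≠ 0) :
    ∃ (φ : StrongDual ℂ Z) (t : characterSpace ℂ C), ‖φ‖ ≤ 1 ∧ φ z = ‖z‖ ∧
      ∀ c y, φ (c • y) = t c * φ y := by
  obtain ⟨φ, hφ, hφz, hext⟩ := exists_extreme_norming z
  have hz0 : φ z ≠ 0 := by rw [hφz]; exact_mod_cast norm_ne_zero_iff.2 hz
  have hzpos : 0 < ‖z‖ := norm_pos_iff.2 hz
  let P : Submodule ℂ C :=
    { carrier := {c | ∃ l : ℂ, ∀ y, φ (c • y) = l * φ y}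
      add_mem' := by
        rintro c d ⟨l, hl⟩ ⟨m, hm⟩
        exact ⟨l + m, fun y => by rw [add_smul, map_add, hl, hm, add_mul]⟩
      zero_mem' := ⟨0, fun y => by simp⟩
      smul_mem' := by
        rintro a c ⟨l, hl⟩
        exact ⟨a * l, fun y => by rw [smul_assoc, map_smul, hl, smul_eq_mul, mul_assoc]⟩ }
  have hP : ∀ c, c ∈ P := mem_of_isPosContraction_mem fun a ha => by
    have hsum : smulDual a φ + smulDual (1 - a) φ = φ := by
      ext y
      rw [add_apply, smulDual_apply, smulDual_apply, ← map_add, ← add_smul,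
        add_sub_cancel, one_smul]
    set α := ‖smulDual a φ‖ with hα
    set β := ‖smulDual (1 - a) φ‖ with hβ
    have h1 : α + β ≤ 1 := (hsplit φ a ha).trans hφ
    have hza : ‖smulDual a φ z‖ ≤ α * ‖z‖ := ContinuousLinearMap.le_opNorm _ _
    have hzb : ‖smulDual (1 - a) φ z‖ ≤ β * ‖z‖ := ContinuousLinearMap.le_opNorm _ _
    have hzsum : smulDual a φ z + smulDual (1 - a) φ z = ‖z‖ := by
      rw [← hφz, ← add_apply, hsum]
    have hre : (smulDual a φ z).re + (smulDual (1 - a) φ z).re = ‖z‖ := by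
      simpa using congrArg Complex.re hzsum
    have hrea := (Complex.re_le_norm (smulDual a φ z)).trans hza
    have hreb := (Complex.re_le_norm (smulDual (1 - a) φ z)).trans hzb
    -- Evaluating at `z` gives `‖z‖ ≤ (α + β) ‖z‖`, so all estimates above are equalities. In
    -- particular each part, divided by its norm, is again norming for `z`.
    have h2 : α + β = 1 := by nlinarith
    have hvala : smulDual a φ z = (α * ‖z‖ : ℝ) := by
      have : (smulDual a φ z).re = α * ‖z‖ := by nlinarith
      exact Complex.ext this (by
        have h3 := Complex.sq_norm (smulDual a φ z)
        rw [Complex.normSq_apply, this] at h3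
        have h4 : ‖smulDual a φ z‖ ^ 2 ≤ (α * ‖z‖) ^ 2 := by gcongr
        simpa using (by nlinarith : (smulDual a φ z).im ^ 2 ≤ 0))
    have hvalb : smulDual (1 - a) φ z = (β * ‖z‖ : ℝ) := by
      rw [hvala] at hzsum
      have : smulDual (1 - a) φ z = ‖z‖ - (α * ‖z‖ : ℝ) := by rw [← hzsum]; ring
      rw [this, ← Complex.ofReal_sub]
      congr 1
      linear_combination (-‖z‖) * h2
    -- If one part vanishes, `a` acts by the scalar `0` or `1`; otherwise `φ` is a proper convex
    -- combination of normalised parts and extremality makes `a` act by `α`.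
    rcases eq_or_lt_of_le (norm_nonneg (smulDual a φ)) with h0 | hα0
    · refine ⟨0, fun y => ?_⟩
      rw [← smulDual_apply, norm_eq_zero.1 h0.symm]; simp
    rcases eq_or_lt_of_le (norm_nonneg (smulDual (1 - a) φ)) with h0 | hβ0
    · refine ⟨1, fun y => ?_⟩
      rw [norm_eq_zero.1 h0.symm, add_zero] at hsum
      rw [← smulDual_apply, hsum, one_mul]
    · have hα' : (α : ℂ) ≠ 0 := by exact_mod_cast hα0.ne'
      have hβ' : (β : ℂ) ≠ 0 := by exact_mod_cast hβ0.ne'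
      have key := hext ((α : ℂ)⁻¹ • smulDual a φ) ((β : ℂ)⁻¹ • smulDual (1 - a) φ)
        (by rw [norm_smul, norm_inv, Complex.norm_real, Real.norm_of_nonneg hα0.le,
              inv_mul_cancel₀ hα0.ne'])
        (by rw [norm_smul, norm_inv, Complex.norm_real, Real.norm_of_nonneg hβ0.le,
              inv_mul_cancel₀ hβ0.ne'])
        (by rw [smul_apply, hvala, smul_eq_mul, Complex.ofReal_mul, inv_mul_cancel_left₀ hα'])
        (by rw [smul_apply, hvalb, smul_eq_mul, Complex.ofReal_mul, inv_mul_cancel_left₀ hβ'])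
        α β hα0 hβ0 h2 (by rw [smul_inv_smul₀ hα', smul_inv_smul₀ hβ', hsum])
      refine ⟨α, fun y => ?_⟩
      have := congrArg (fun ψ : StrongDual ℂ Z => ψ y) key
      simp only [smul_apply, smulDual_apply, smul_eq_mul] at this
      rw [← this, mul_inv_cancel_left₀ hα']
  -- The scalars are unique because `φ z ≠ 0`; uniqueness makes `χ` linear and multiplicative.
  choose χ hχ using hP
  have hχu : ∀ c l, (φ (c • z) = l * φ z) → χ c = l := fun c l h =>
    mul_right_cancel₀ hz0 ((hχ c z).symm.trans h)
  let f : C →ₐ[ℂ] ℂ := AlgHom.ofLinearMap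
    { toFun := χ
      map_add' := fun c d => hχu _ _ (by rw [add_smul, map_add, hχ, hχ, add_mul])
      map_smul' := fun a c => hχu _ _ (by
        rw [smul_assoc, map_smul, hχ, RingHom.id_apply, smul_eq_mul, smul_eq_mul, mul_assoc]) }
    (hχu _ _ (by rw [one_smul, one_mul]))
    (fun c d => hχu _ _ (by rw [mul_smul, hχ, hχ, mul_assoc]; rfl))
  exact ⟨φ, CharacterSpace.equivAlgHom.symm f, hφ, hφz, hχ⟩

/-- The scalar representation given by a character. -/
noncomputable def charRep (t : characterSpace ℂ C) : C →⋆ₐ[ℂ] (ℂ →L[ℂ] ℂ) where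
  toFun c := algebraMap ℂ (ℂ →L[ℂ] ℂ) (t c)
  map_one' := by rw [map_one, map_one]
  map_mul' c d := by rw [map_mul, map_mul]
  map_zero' := by rw [map_zero, map_zero]
  map_add' c d := by rw [map_add, map_add]
  commutes' r := by rw [AlgHomClass.commutes]; rfl
  map_star' c := by rw [map_star, algebraMap_star_comm]

/-- A functional over a character `t` is a bimodule map into `B(ℂ)` for the scalar representation
`t`, and such functionals norm `Z`; their direct sum is the required isometry. -/
lemma isCRM_of_split [CompleteSpace Z]
    (hsplit : ∀ (φ : StrongDual ℂ Z) (a : C), IsPosContraction a →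
      ‖smulDual a φ‖ + ‖smulDual (1 - a) φ‖ ≤ ‖φ‖) : IsCRM C Z := by
  let ι := {p : StrongDual ℂ Z × characterSpace ℂ C //
    ‖p.1‖ ≤ 1 ∧ ∀ c y, p.1 (c • y) = p.2 c * p.1 y}
  let Φ : ι → Z →ₗ[ℂ] (ℂ →L[ℂ] ℂ) := fun p => (p.1.1 : Z →ₗ[ℂ] ℂ).smulRight 1
  have hΦ : ∀ (p : ι) z, ‖Φ p z‖ = ‖p.1.1 z‖ := fun p z => by
    change ‖p.1.1 z • (1 : ℂ →L[ℂ] ℂ)‖ = _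
    rw [norm_smul, norm_one, mul_one]
  have hmul : ∀ (p : ι) (c : C) z, Φ p (c • z) = charRep p.1.2 c ∘L Φ p z := fun p c z => by
    ext
    change p.1.1 (c • z) * 1 = p.1.2 c * (p.1.1 z * 1)
    rw [p.2.2, mul_one, mul_one]
  have hcomm : ∀ S T : ℂ →L[ℂ] ℂ, S ∘L T = T ∘L S := fun S T => by
    ext
    have h1 := S.map_smul (T 1) 1
    have h2 := T.map_smul (S 1) 1
    simp only [smul_eq_mul, mul_one] at h1 h2
    simp [h1, h2, mul_comm]
  obtain ⟨Ψ, hΨ⟩ := exists_sum_isometry (fun p : ι => charRep p.1.2) Φ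
    (fun p c z => ⟨hmul p c z, (hmul p c z).trans (hcomm _ _)⟩)
    (fun p z => (hΦ p z).trans_le (by simpa using p.1.1.le_of_opNorm_le p.2.1 z))
    (fun z r hr hr0 => by
      obtain ⟨φ, t, h1, h2, h3⟩ := exists_character_norming hsplit
        (norm_pos_iff.1 (hr0.trans_lt hr))
      exact ⟨⟨(φ, t), h1, h3⟩, by rw [hΦ, h2, Complex.norm_real, norm_norm]; exact hr.le⟩)
  exact ⟨inferInstance, _, _, _, inferInstance, _, _, _, inferInstance, _, _, Ψ, hΨ⟩

end KreinMilman


/-! ### Approximating a positive contraction by a mean of near-projections -/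

section Clamp

/-- The function `r ↦ r - k`, truncated to `[0, 1]`. -/
def clamp (k : ℕ) (r : ℝ) : ℝ := min (max (r - k) 0) 1

lemma clamp_nonneg (k : ℕ) (r : ℝ) : 0 ≤ clamp k r := le_min (le_max_right _ _) zero_le_one

lemma clamp_le_one (k : ℕ) (r : ℝ) : clamp k r ≤ 1 := min_le_right _ _

lemma continuous_clamp (k : ℕ) : Continuous (clamp k) := by unfold clamp; fun_prop

/-- For `r ≥ 0`, `clamp k r` is the length of the part of `[0, r]` lying in `[k, k + 1]`; the layers
add up. -/
lemma sum_clamp (n : ℕ) {r : ℝ} (hr : 0 ≤ r) : ∑ k ∈ Finset.range n, clamp k r = min r n := by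
  induction n with
  | zero => simp [hr]
  | succ n ih =>
    rw [Finset.sum_range_succ, ih, clamp, Nat.cast_succ]
    rcases le_total r n with h | h
    · rw [min_eq_left h, max_eq_right (by linarith), min_eq_left zero_le_one,
        min_eq_left (by linarith), add_zero]
    · rw [min_eq_right h, max_eq_left (by linarith)]
      rcases le_total (r - n) 1 with h' | h'
      · rw [min_eq_left h', min_eq_left (by linarith)]; ring
      · rw [min_eq_right h', min_eq_right (by linarith)]

/-- The left side is nonzero only for `k < r < k + 1`, where the next layer is still empty. The
right side telescopes, which bounds the total defect uniformly in the number of layers. -/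
lemma clamp_mul_one_sub_le (k : ℕ) (r : ℝ) :
    clamp k r * (1 - clamp k r) ≤ clamp k r - clamp (k + 1) r := by
  have h0 := clamp_nonneg k r
  have h1 := clamp_le_one k r
  rcases le_total r (k + 1) with h | h
  · have : clamp (k + 1) r = 0 := by
      rw [clamp, Nat.cast_succ, max_eq_right (by linarith), min_eq_left zero_le_one]
    rw [this]
    nlinarith
  · have : clamp k r = 1 := by
      rw [clamp, min_eq_right (le_max_of_le_left (by linarith))]
    rw [this]
    linarith [clamp_le_one (k + 1) r]

lemma sum_clamp_mul_one_sub_le (n : ℕ) (r : ℝ) :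
    ∑ k ∈ Finset.range n, clamp k r * (1 - clamp k r) ≤ 1 := by
  refine (Finset.sum_le_sum fun k _ => clamp_mul_one_sub_le k r).trans ?_
  rw [Finset.sum_range_sub' (fun k => clamp k r)]
  linarith [clamp_le_one 0 r, clamp_nonneg n r]

variable {C : Type u} [CommCStarAlgebra C]

/-- A positive contraction is the mean of positive contractions that are nearly projections. -/
lemma IsPosContraction.exists_sum {a : C} (ha : IsPosContraction a) (n : ℕ) :
    ∃ p : ℕ → C, (∀ k, IsPosContraction (p k)) ∧ ∑ k ∈ Finset.range n, p k = (n : ℂ) • a ∧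
      ‖∑ k ∈ Finset.range n, p k * (1 - p k)‖ ≤ 1 := by
  -- `p k` is the `k`-th unit layer of `n a`, whose transform has values in `[0, n]`.
  let p : ℕ → C := fun k => ofFun ⟨fun t => (clamp k (n * (t a).re) : ℂ),
    Complex.continuous_ofReal.comp ((continuous_clamp k).comp (continuous_const.mul
      (Complex.continuous_re.comp (gelfandTransform ℂ C a).continuous)))⟩
  have hp : ∀ (k : ℕ) (t : characterSpace ℂ C), t (p k) = (clamp k (n * (t a).re) : ℂ) := fun k t => apply_ofFun _ t
  refine ⟨p, fun k t => ⟨_, clamp_nonneg _ _, clamp_le_one _ _, hp k t⟩, ext_char fun t => ?_,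
    norm_le_of_char zero_le_one fun t => ?_⟩
  · obtain ⟨r, h0, h1, hr⟩ := ha t
    rw [map_sum, map_smul, Finset.sum_congr rfl fun k _ => hp k t, ← Complex.ofReal_sum,
      hr, Complex.ofReal_re, sum_clamp n (by positivity),
      min_eq_left (mul_le_of_le_one_right n.cast_nonneg h1)]
    simp
  · have : t (∑ k ∈ Finset.range n, p k * (1 - p k)) =
        ((∑ k ∈ Finset.range n, clamp k (n * (t a).re) * (1 - clamp k (n * (t a).re)) : ℝ) : ℂ) := by
      rw [map_sum, Complex.ofReal_sum]
      exact Finset.sum_congr rfl fun k _ => by rw [map_mul, map_sub, map_one, hp]; simp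
    rw [this, Complex.norm_real, Real.norm_of_nonneg (Finset.sum_nonneg fun k _ =>
      mul_nonneg (clamp_nonneg _ _) (sub_nonneg.2 (clamp_le_one _ _)))]
    exact sum_clamp_mul_one_sub_le n _

end Clamp

/-! ### The tensor product over `C`: dual norms and the splitting inequality -/

section ModTmul

variable {C : Type u} [CommCStarAlgebra C]
variable {X : Type v} [NormedAddCommGroup X] [NormedSpace ℂ X]
  [Module C X] [IsScalarTower ℂ C X] [IsBoundedSMul C X]
variable {Y : Type w} [NormedAddCommGroup Y] [NormedSpace ℂ Y]
  [Module C Y] [IsScalarTower ℂ C Y] [IsBoundedSMul C Y]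

variable (C) in
/-- The canonical map from the algebraic tensor product to the projective tensor product over
`C`. -/
noncomputable def toModTensor : AlgTensor X Y →ₗ[ℂ] ModTensor C X Y where
  toFun w := Submodule.Quotient.mk (w : ProjTensor X Y)
  map_add' w z := by rw [Completion.coe_add, Submodule.Quotient.mk_add]
  map_smul' a w := by rw [Completion.coe_smul, Submodule.Quotient.mk_smul, RingHom.id_apply]

lemma norm_toModTensor_le (w : AlgTensor X Y) : ‖toModTensor C w‖ ≤ ‖w‖ :=
  (Submodule.Quotient.norm_mk_le _ _).trans (Completion.norm_coe w).le

variable (C) in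
/-- The elementary tensor `x ⊗ y` in the projective tensor product over `C`. -/
noncomputable def modTmul (x : X) (y : Y) : ModTensor C X Y := toModTensor C (AlgTensor.tmul x y)

lemma modTmul_add (x : X) (y y' : Y) : modTmul C x (y + y') = modTmul C x y + modTmul C x y' :=
  (congrArg (toModTensor C) (TensorProduct.tmul_add x y y')).trans (map_add _ _ _)

lemma add_modTmul (x x' : X) (y : Y) : modTmul C (x + x') y = modTmul C x y + modTmul C x' y :=
  (congrArg (toModTensor C) (TensorProduct.add_tmul x x' y)).trans (map_add _ _ _)

lemma complex_smul_modTmul (a : ℂ) (x : X) (y : Y) :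
    modTmul C (a • x) y = a • modTmul C x y :=
  (congrArg (toModTensor C) (TensorProduct.smul_tmul' (R := ℂ) a x y).symm).trans (map_smul _ _ _)

lemma modTmul_complex_smul (a : ℂ) (x : X) (y : Y) :
    modTmul C x (a • y) = a • modTmul C x y :=
  (congrArg (toModTensor C) (TensorProduct.tmul_smul (R := ℂ) a x y)).trans (map_smul _ _ _)

lemma smul_modTmul (c : C) (x : X) (y : Y) : modTmul C (c • x) y = c • modTmul C x y := by
  change Submodule.Quotient.mk _ = c • Submodule.Quotient.mk _
  rw [← Submodule.Quotient.mk_smul, ← Completion.coe_smul, AlgTensor.smul_tmul']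

lemma modTmul_smul (c : C) (x : X) (y : Y) : modTmul C x (c • y) = c • modTmul C x y := by
  rw [← smul_modTmul]
  refine ((Submodule.Quotient.eq _).2 ?_).symm
  rw [← Completion.coe_sub]
  exact Submodule.le_topologicalClosure _ (Submodule.subset_span ⟨x, c, y, rfl⟩)

lemma norm_modTmul_le (x : X) (y : Y) : ‖modTmul C x y‖ ≤ ‖x‖ * ‖y‖ :=
  (norm_toModTensor_le _).trans (AlgTensor.norm_le_of_mem (AlgTensor.tmul_mem_costs x y))

/-- The norm of a functional on the projective tensor product is determined by elementary
tensors. -/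
lemma norm_dual_le (φ : StrongDual ℂ (ModTensor C X Y)) {r : ℝ} (hr : 0 ≤ r)
    (h : ∀ (x : X) (y : Y), ‖x‖ ≤ 1 → ‖y‖ ≤ 1 → ‖φ (modTmul C x y)‖ ≤ r) : ‖φ‖ ≤ r := by
  have h1 : ∀ (x : X) (y : Y), ‖φ (modTmul C x y)‖ ≤ r * (‖x‖ * ‖y‖) := fun x y => by
    rcases eq_or_ne x 0 with rfl | hx
    · rw [norm_zero, zero_mul, mul_zero]
      exact (φ.le_opNorm _).trans (by
        have := norm_modTmul_le (C := C) (0 : X) y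
        rw [norm_zero, zero_mul] at this
        exact mul_nonpos_of_nonneg_of_nonpos (norm_nonneg _) this)
    rcases eq_or_ne y 0 with rfl | hy
    · rw [norm_zero, mul_zero, mul_zero]
      exact (φ.le_opNorm _).trans (by
        have := norm_modTmul_le (C := C) x (0 : Y)
        rw [norm_zero, mul_zero] at this
        exact mul_nonpos_of_nonneg_of_nonpos (norm_nonneg _) this)
    have hx' : (‖x‖ : ℂ) ≠ 0 := by exact_mod_cast norm_ne_zero_iff.2 hx
    have hy' : (‖y‖ : ℂ) ≠ 0 := by exact_mod_cast norm_ne_zero_iff.2 hy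
    have hxy : modTmul C x y =
        (‖x‖ : ℂ) • (‖y‖ : ℂ) • modTmul C ((‖x‖ : ℂ)⁻¹ • x) ((‖y‖ : ℂ)⁻¹ • y) := by
      rw [← modTmul_complex_smul, ← complex_smul_modTmul, smul_inv_smul₀ hx', smul_inv_smul₀ hy']
    have h2 := h ((‖x‖ : ℂ)⁻¹ • x) ((‖y‖ : ℂ)⁻¹ • y)
      (by rw [norm_smul, norm_inv, Complex.norm_real, norm_norm,
        inv_mul_cancel₀ (norm_ne_zero_iff.2 hx)])
      (by rw [norm_smul, norm_inv, Complex.norm_real, norm_norm,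
        inv_mul_cancel₀ (norm_ne_zero_iff.2 hy)])
    rw [hxy, map_smul, map_smul, norm_smul, norm_smul, Complex.norm_real, Complex.norm_real,
      norm_norm, norm_norm]
    calc ‖x‖ * (‖y‖ * _) ≤ ‖x‖ * (‖y‖ * r) := by gcongr
      _ = r * (‖x‖ * ‖y‖) := by ring
  have h2 : ∀ w : AlgTensor X Y, ‖φ (toModTensor C w)‖ ≤ r * ‖w‖ := fun w => by
    refine le_of_forall_pos_le_add fun ε hε => ?_
    -- The denominator `r + 1` avoids the case `r = 0`.
    obtain ⟨s, ⟨n, x, y, hw, rfl⟩, hs'⟩ := AlgTensor.exists_lt (w := w) (b := ‖w‖ + ε / (r + 1))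
      (lt_add_of_pos_right _ (by positivity))
    calc ‖φ (toModTensor C w)‖ = ‖∑ j, φ (modTmul C (x j) (y j))‖ := by
          rw [hw, map_sum, map_sum]; rfl
      _ ≤ ∑ j, r * (‖x j‖ * ‖y j‖) := norm_sum_le_of_le _ fun j _ => h1 _ _
      _ = r * ∑ j, ‖x j‖ * ‖y j‖ := by rw [Finset.mul_sum]
      _ ≤ r * (‖w‖ + ε / (r + 1)) := by gcongr
      _ ≤ r * ‖w‖ + ε := by
        rw [mul_add, mul_div_assoc']
        gcongr
        rw [div_le_iff₀ (by positivity)]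
        nlinarith
  have h3 : ∀ z : ProjTensor X Y,
      ‖φ (Submodule.Quotient.mk z : ModTensor C X Y)‖ ≤ r * ‖z‖ := fun z => by
    induction z using Completion.induction_on with
    | hp =>
      have hmk : Continuous (Submodule.Quotient.mk : ProjTensor X Y → ModTensor C X Y) :=
        continuous_quot_mk
      exact isClosed_le (φ.continuous.comp hmk).norm (continuous_const.mul continuous_norm)
    | ih w =>
      exact (h2 w).trans_eq (congrArg (r * ·) (Completion.norm_coe w).symm)
  refine φ.opNorm_le_bound hr fun z => le_of_forall_pos_le_add fun ε hε => ?_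
  obtain ⟨m, rfl, hm⟩ := Submodule.Quotient.norm_mk_lt z (show 0 < ε / (r + 1) by positivity)
  calc _ ≤ r * ‖m‖ := h3 m
    _ ≤ r * (‖(Submodule.Quotient.mk m : ModTensor C X Y)‖ + ε / (r + 1)) :=
      mul_le_mul_of_nonneg_left hm.le hr
    _ ≤ _ := by
      rw [mul_add, mul_div_assoc']
      gcongr
      rw [div_le_iff₀ (by positivity)]
      nlinarith

variable (C X) in
/-- The unit ball of `X` is stable under convex combinations with coefficients in `C`. -/
def IsModuleConvex : Prop :=
  ∀ (a : C) (x y : X), IsPosContraction a → ‖x‖ ≤ 1 → ‖y‖ ≤ 1 → ‖a • x + (1 - a) • y‖ ≤ 1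

lemma norm_le_of_mul_le {E : Type*} [NormedAddCommGroup E] {z : E} {r : ℝ} (hr : ∀ n : ℕ, n * ‖z‖ ≤ n + r) : ‖z‖ ≤ 1 := by
  by_contra! h
  obtain ⟨n, hn⟩ := exists_nat_gt (r / (‖z‖ - 1))
  rw [div_lt_iff₀ (by linarith)] at hn
  linarith [hr n]

/-- `C`-convex combinations of elementary tensors in the projective unit ball. -/
lemma norm_convex_modTmul_le (hX : IsModuleConvex C X) (hY : IsModuleConvex C Y) {a : C}
    (ha : IsPosContraction a) {x x' : X} {y y' : Y} (hx : ‖x‖ ≤ 1) (hx' : ‖x'‖ ≤ 1)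
    (hy : ‖y‖ ≤ 1) (hy' : ‖y'‖ ≤ 1) :
    ‖a • modTmul C x y + (1 - a) • modTmul C x' y'‖ ≤ 1 := by
  -- The constant bounds `‖D‖` below, a signed sum of four elementary tensors in the unit ball.
  refine norm_le_of_mul_le (r := 4) fun n => ?_
  obtain ⟨p, hp, hsum, hq⟩ := ha.exists_sum n
  set q := ∑ k ∈ Finset.range n, p k * (1 - p k) with hq'
  set D := modTmul C x y + modTmul C x' y' - modTmul C x y' - modTmul C x' y
  have h1 : ∀ (x : X) (y : Y), ‖x‖ ≤ 1 → ‖y‖ ≤ 1 → ‖modTmul C x y‖ ≤ 1 := fun x y hx hy =>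
    (norm_modTmul_le x y).trans (mul_le_one₀ hx (norm_nonneg y) hy)
  have hD : ‖D‖ ≤ 4 := by
    refine (norm_sub_le _ _).trans ?_
    have := norm_sub_le (modTmul C x y + modTmul C x' y') (modTmul C x y')
    have := norm_add_le (modTmul C x y) (modTmul C x' y')
    linarith [h1 x y hx hy, h1 x' y' hx' hy', h1 x y' hx hy', h1 x' y hx' hy]
  -- For a projection `p k` the defect `p k * (1 - p k)` would vanish and the identity would be
  -- exact; in general the cross terms assemble into `D`.
  have hterm : ∀ k, modTmul C (p k • x + (1 - p k) • x') (p k • y + (1 - p k) • y') =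
      p k • modTmul C x y + (1 - p k) • modTmul C x' y' - (p k * (1 - p k)) • D := fun k => by
    simp only [add_modTmul, modTmul_add, smul_modTmul, modTmul_smul, D]
    module
  have hid : (n : ℂ) • (a • modTmul C x y + (1 - a) • modTmul C x' y') =
      ∑ k ∈ Finset.range n, modTmul C (p k • x + (1 - p k) • x') (p k • y + (1 - p k) • y') +
        q • D := by
    simp only [hterm, Finset.sum_sub_distrib, Finset.sum_add_distrib, ← Finset.sum_smul, hsum,
      ← hq', sub_add_cancel]
    rw [Finset.sum_const, Finset.card_range, smul_add, ← smul_assoc, ← smul_assoc, smul_sub,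
      Nat.cast_smul_eq_nsmul ℂ n (1 : C)]
  have hn : (n : ℝ) * ‖a • modTmul C x y + (1 - a) • modTmul C x' y'‖ =
      ‖(n : ℂ) • (a • modTmul C x y + (1 - a) • modTmul C x' y')‖ := by
    rw [norm_smul, Complex.norm_natCast]
  rw [hn, hid]
  refine (norm_add_le _ _).trans (add_le_add ?_ ?_)
  · refine (norm_sum_le_of_le _ fun k _ => h1 _ _ (hX _ _ _ (hp k) hx hx')
      (hY _ _ _ (hp k) hy hy')).trans (by simp)
  · exact (norm_smul_le q D).trans ((mul_le_mul hq hD (norm_nonneg _) zero_le_one).trans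
      (by norm_num))

/-- The splitting inequality is dual to the estimate for `C`-convex combinations of two elementary
tensors, since functional norms are attained as suprema over elementary tensors. -/
lemma isCRM_modTensor (hX : IsModuleConvex C X) (hY : IsModuleConvex C Y) :
    IsCRM C (ModTensor C X Y) := by
  refine isCRM_of_split fun φ a ha => ?_
  have key : ∀ (x x' : X) (y y' : Y), ‖x‖ ≤ 1 → ‖x'‖ ≤ 1 → ‖y‖ ≤ 1 → ‖y'‖ ≤ 1 →
      ‖smulDual a φ (modTmul C x y)‖ + ‖smulDual (1 - a) φ (modTmul C x' y')‖ ≤ ‖φ‖ := by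
    intro x x' y y' hx hx' hy hy'
    -- Rotating `x` and `x'` by phases makes both values nonnegative, so the sum of moduli is `φ` at
    -- one `C`-convex combination.
    obtain ⟨θ, hθ, h1⟩ := RCLike.exists_norm_eq_mul_self (smulDual a φ (modTmul C x y))
    obtain ⟨θ', hθ', h2⟩ := RCLike.exists_norm_eq_mul_self (smulDual (1 - a) φ (modTmul C x' y'))
    have h3 : ((‖smulDual a φ (modTmul C x y)‖ + ‖smulDual (1 - a) φ (modTmul C x' y')‖ : ℝ) : ℂ) =
        φ (a • modTmul C (θ • x) y + (1 - a) • modTmul C (θ' • x') y') := by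
      rw [map_add, ← smulDual_apply, ← smulDual_apply, complex_smul_modTmul, complex_smul_modTmul,
        map_smul, map_smul, smul_eq_mul, smul_eq_mul, Complex.ofReal_add]
      exact congrArg₂ _ h1 h2
    have h4 := norm_convex_modTmul_le hX hY ha (x := θ • x) (x' := θ' • x')
      (by rwa [norm_smul, hθ, one_mul]) (by rwa [norm_smul, hθ', one_mul]) hy hy'
    have h5 := φ.le_of_opNorm_le_of_le le_rfl h4
    rwa [← h3, Complex.norm_real, mul_one, Real.norm_of_nonneg (by positivity)] at h5
  -- The two pairs vary independently: take the supremum over `x`, `y` first, then over `x'`, `y'`.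
  have key' : ∀ (x' : X) (y' : Y), ‖x'‖ ≤ 1 → ‖y'‖ ≤ 1 →
      ‖smulDual (1 - a) φ (modTmul C x' y')‖ ≤ ‖φ‖ - ‖smulDual a φ‖ := fun x' y' hx' hy' => by
    rw [le_sub_comm]
    refine norm_dual_le _ ?_ fun x y hx hy => le_sub_iff_add_le.2 (key x x' y y' hx hx' hy hy')
    rw [sub_nonneg]
    exact (le_add_of_nonneg_left (norm_nonneg _)).trans
      (key 0 x' 0 y' (by simp) hx' (by simp) hy')
  have h0 : 0 ≤ ‖φ‖ - ‖smulDual a φ‖ := (norm_nonneg _).trans (key' 0 0 (by simp) (by simp))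
  linarith [norm_dual_le (smulDual (1 - a) φ) h0 key']

end ModTmul

section FunctionModules

variable {C : Type u} [CommCStarAlgebra C] {U : Type v} [NormedAddCommGroup U] [NormedSpace ℂ U]

lemma isModuleConvex_vecFun : IsModuleConvex C (VecFun C U) := fun a f g ha hf hg =>
  (VecFun.norm_le zero_le_one).2 fun t => by
    obtain ⟨r, h0, h1, hr⟩ := ha t
    rw [VecFun.add_apply, VecFun.smul_apply, VecFun.smul_apply, map_sub, map_one, hr]
    refine (norm_add_le _ _).trans ?_
    rw [norm_smul, norm_smul, ← Complex.ofReal_one, ← Complex.ofReal_sub, Complex.norm_real,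
      Complex.norm_real, Real.norm_of_nonneg h0, Real.norm_of_nonneg (sub_nonneg.2 h1)]
    nlinarith [f.norm_apply_le t, g.norm_apply_le t, norm_nonneg (f t), norm_nonneg (g t)]

lemma isModuleConvex_pinnedFun (t₀ : characterSpace ℂ C) (U₀ : Submodule ℂ U) :
    IsModuleConvex C (pinnedFun t₀ U₀) := fun a f g ha hf hg =>
  isModuleConvex_vecFun a (f : VecFun C U) g ha hf hg

end FunctionModules


/-! ### The operator order on `M` and contractions vanishing at a point -/

section Order

/-- Take for `b` the square root of the nonnegative transform. Positivity in the form `star b * b`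
is preserved by every *-representation. -/
lemma exists_star_mul_self_of_char {C : Type u} [CommCStarAlgebra C] {c d : C}
    (h : ∀ t : characterSpace ℂ C, ∃ r : ℝ, 0 ≤ r ∧ t d - t c = r) :
    ∃ b : C, d - c = star b * b := by
  let b : C := ofFun ⟨fun t => (√((t (d - c)).re) : ℂ), Complex.continuous_ofReal.comp
    (Real.continuous_sqrt.comp (Complex.continuous_re.comp
      (gelfandTransform ℂ C (d - c)).continuous))⟩
  refine ⟨b, ext_char fun t => ?_⟩
  obtain ⟨r, hr, ht⟩ := h t
  have h1 : t b = (√r : ℂ) := by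
    refine (apply_ofFun _ t).trans ?_
    change ((√((t (d - c)).re) : ℝ) : ℂ) = _
    rw [map_sub, ht, Complex.ofReal_re]
  rw [map_mul, map_star, h1, map_sub, ht, RCLike.star_def, Complex.conj_ofReal,
    ← Complex.ofReal_mul, Real.mul_self_sqrt hr]

variable {H : Type u} [NormedAddCommGroup H] [InnerProductSpace ℂ H] [CompleteSpace H]
  {M : VonNeumannAlgebra H} [IsMulCommutative M]

lemma le_of_char {c d : M} (h : ∀ t : characterSpace ℂ M, ∃ r : ℝ, 0 ≤ r ∧ t d - t c = r) :
    c ≤ d := by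
  obtain ⟨b, hb⟩ := exists_star_mul_self_of_char h
  have hb' : (d : H →L[ℂ] H) - c = star (b : H →L[ℂ] H) * b := congrArg Subtype.val hb
  change (c : H →L[ℂ] H) ≤ d
  rw [← sub_nonneg, hb']
  exact star_mul_self_nonneg _

/-- Let `n` be the negative part of `d - c` on the spectrum. The operator `n (d - c) n` is positive
by conjugation, but its transform is `-n³ ≤ 0`; so it vanishes, and the transform of `d - c` has no
negative value. -/
lemma char_of_le {c d : M} (h : c ≤ d) (t : characterSpace ℂ M) :
    ∃ r : ℝ, 0 ≤ r ∧ t d - t c = r := by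
  have hpos : (0 : H →L[ℂ] H) ≤ (d : H →L[ℂ] H) - c := sub_nonneg.2 h
  have hsa : star (d - c) = d - c := Subtype.ext hpos.isSelfAdjoint
  have hreal : ∀ s : characterSpace ℂ M, s (d - c) = ((s (d - c)).re : ℂ) := fun s => by
    have := map_star s (d - c)
    rw [hsa] at this
    exact (Complex.conj_eq_iff_re.1 this.symm).symm
  let n : M := ofFun ⟨fun s => (max (-(s (d - c)).re) 0 : ℝ), Complex.continuous_ofReal.comp
    ((Complex.continuous_re.comp (gelfandTransform ℂ M (d - c)).continuous).neg.max
      continuous_const)⟩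
  have hn : ∀ s : characterSpace ℂ M, s n = (max (-(s (d - c)).re) 0 : ℝ) := fun s =>
    apply_ofFun _ s
  have hnsa : star n = n := ext_char fun s => by
    rw [map_star, hn, RCLike.star_def, Complex.conj_ofReal]
  have h1 : (0 : M) ≤ star n * (d - c) * n := by
    change (0 : H →L[ℂ] H) ≤ star (n : H →L[ℂ] H) * ((d : H →L[ℂ] H) - c) * n
    exact star_left_conjugate_nonneg hpos _
  have h2 : star n * (d - c) * n ≤ 0 := le_of_char fun s => by
    refine ⟨-(s (d - c)).re * (max (-(s (d - c)).re) 0) ^ 2, ?_, ?_⟩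
    · rcases le_total (-(s (d - c)).re) 0 with h | h
      · rw [max_eq_right h]; simp
      · positivity
    · rw [map_mul, map_mul, hnsa, hn, map_zero, hreal s]
      push_cast
      simp only [Complex.ofReal_re]
      ring
  have h3 : t (star n * (d - c) * n) = 0 := by rw [le_antisymm h2 h1, map_zero]
  refine ⟨(t (d - c)).re, ?_, by rw [← map_sub]; exact hreal t⟩
  by_contra! hneg
  rw [map_mul, map_mul, hnsa, hn, max_eq_left (by linarith), hreal t] at h3
  have h4 : -(t (d - c)).re * (t (d - c)).re * -(t (d - c)).re = 0 := by exact_mod_cast h3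
  have : (t (d - c)).re ≠ 0 := hneg.ne
  exact pow_ne_zero 3 this (by linear_combination h4)

/-- The positive contractions that vanish at `t₀`. -/
def vanishingContractions (t₀ : characterSpace ℂ M) : Set M :=
  {c | IsPosContraction c ∧ t₀ c = 0}

lemma zero_mem_vanishingContractions (t₀ : characterSpace ℂ M) :
    (0 : M) ∈ vanishingContractions t₀ :=
  ⟨fun t => ⟨0, le_rfl, zero_le_one, by simp⟩, map_zero t₀⟩

lemma directedOn_vanishingContractions (t₀ : characterSpace ℂ M) :
    DirectedOn (· ≤ ·) (vanishingContractions t₀) := by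
  rintro c ⟨hc, hc0⟩ d ⟨hd, hd0⟩
  -- This upper bound of `c` and `d` keeps values in `[0, 1]` and still vanishes at `t₀`.
  refine ⟨1 - (1 - c) * (1 - d), ⟨fun t => ?_, by simp [hc0, hd0]⟩, le_of_char fun t => ?_,
    le_of_char fun t => ?_⟩
  all_goals
    obtain ⟨r, h0, h1, hr⟩ := hc t
    obtain ⟨s, k0, k1, hs⟩ := hd t
  · refine ⟨1 - (1 - r) * (1 - s), by nlinarith, by nlinarith, by simp [hr, hs]⟩
  · exact ⟨(1 - r) * s, mul_nonneg (by linarith) k0, by simp [hr, hs]; ring⟩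
  · exact ⟨(1 - s) * r, mul_nonneg (by linarith) h0, by simp [hr, hs]; ring⟩

lemma exists_vanishingContraction {t₀ t : characterSpace ℂ M} (ht : t ≠ t₀) :
    ∃ c ∈ vanishingContractions t₀, t c = 1 := by
  obtain ⟨f, h0, h1, hf⟩ := exists_continuous_zero_one_of_isClosed
    (isClosed_singleton (x := t₀)) (isClosed_singleton (x := t))
    (Set.disjoint_singleton.2 ht.symm)
  let c : M := ofFun ⟨fun s => (f s : ℂ), Complex.continuous_ofReal.comp f.continuous⟩
  have hc : ∀ s : characterSpace ℂ M, s c = f s := fun s => apply_ofFun _ s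
  refine ⟨c, ⟨fun s => ⟨f s, (hf s).1, (hf s).2, hc s⟩, ?_⟩, ?_⟩
  · rw [hc, h0 rfl]; simp
  · rw [hc, h1 rfl]; simp

/-- By Urysohn an upper bound has transform at least `1` off `t₀`; as `t₀` is not isolated, its
complement is dense and continuity gives the bound at `t₀` too. -/
lemma isLUB_vanishingContractions {t₀ : characterSpace ℂ M}
    (ht₀ : ¬ IsOpen ({t₀} : Set (characterSpace ℂ M))) :
    IsLUB (vanishingContractions t₀) (1 : M) := by
  refine ⟨fun c hc => le_of_char fun t => ?_, fun b hb => le_of_char fun t => ?_⟩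
  · obtain ⟨r, -, h1, hr⟩ := hc.1 t
    exact ⟨1 - r, by linarith, by simp [hr]⟩
  · have hcl : IsClosed {s : characterSpace ℂ M | 1 ≤ (s b).re} :=
      isClosed_le continuous_const
        (Complex.continuous_re.comp (gelfandTransform ℂ M b).continuous)
    have hne : ∀ s : characterSpace ℂ M, s ≠ t₀ → 1 ≤ (s b).re := fun s hs => by
      obtain ⟨c, hc, hc1⟩ := exists_vanishingContraction hs
      obtain ⟨r, hr, h⟩ := char_of_le (hb hc) s
      rw [hc1] at h
      have := congrArg Complex.re h
      simp only [Complex.sub_re, Complex.one_re, Complex.ofReal_re] at this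
      linarith
    have hdense : Dense ({t₀}ᶜ : Set (characterSpace ℂ M)) := dense_compl_singleton_iff_not_open.2 ht₀
    have hall : 1 ≤ (t b).re := by
      have := hcl.closure_subset_iff.2 (show ({t₀}ᶜ : Set _) ⊆ _ from hne)
      rw [hdense.closure_eq] at this
      exact this (Set.mem_univ t)
    obtain ⟨r, -, h⟩ := char_of_le (hb (zero_mem_vanishingContractions t₀)) t
    rw [map_zero, sub_zero] at h
    rw [h, Complex.ofReal_re] at hall
    exact ⟨r - 1, by linarith, by simp [h]⟩

end Order

/-! ### Norm semicontinuity in normal modules -/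

section NotNormal

/-- In a normal representable module, the norm of `z` is at most `β` if all `c z` have norm at most
`β`, for `c` in an increasing net with supremum `1`. -/
lemma IsCNRM.norm_le {C : Type u} [CommCStarAlgebra C] [PartialOrder C] {Z : Type v}
    [NormedAddCommGroup Z] [NormedSpace ℂ Z] [Module C Z] (hZ : IsCNRM C Z) {S : Set C}
    (hne : S.Nonempty) (hdir : DirectedOn (· ≤ ·) S) (hsa : ∀ s ∈ S, IsSelfAdjoint s)
    (hmono : ∀ c d : C, c ≤ d → ∃ b : C, d - c = star b * b)
    (hS : IsLUB S 1) {z : Z} {β : ℝ} (hβ : ∀ c ∈ S, ‖c • z‖ ≤ β) : ‖z‖ ≤ β := by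
  obtain ⟨-, K, _, _, _, L, _, _, _, π, σ, Φ, hπ, -, hΦ⟩ := hZ
  have hle : ∀ c d : C, c ≤ d → π c ≤ π d := fun c d h => by
    obtain ⟨b, hb⟩ := hmono c d h
    rw [← sub_nonneg, ← map_sub, hb, map_mul, map_star]
    exact star_mul_self_nonneg _
  have hβ0 : 0 ≤ β := by
    obtain ⟨c, hc⟩ := hne
    exact (norm_nonneg _).trans (hβ c hc)
  rw [← Φ.norm_map]
  refine (Φ z).opNorm_le_bound hβ0 fun ξ => ?_
  set η := Φ z ξ
  -- By normality `⟨π(c) η, η⟩` comes within `ε` of `‖η‖²`, while `π(c) η = Φ(c z) ξ` has norm at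
  -- most `β ‖ξ‖`.
  have hsq : ‖η‖ ^ 2 ≤ β * ‖ξ‖ * ‖η‖ := by
    refine le_of_forall_pos_le_add fun ε hε => ?_
    obtain ⟨_, ⟨c, hc, rfl⟩, h⟩ := exists_re_inner_sub_le_of_isLUB (hne.image π)
      (by
        rintro _ ⟨s, hs, rfl⟩ _ ⟨t, ht, rfl⟩
        obtain ⟨r, hr, h1, h2⟩ := hdir s hs t ht
        exact ⟨_, ⟨r, hr, rfl⟩, hle _ _ h1, hle _ _ h2⟩)
      (hπ S 1 hne hdir hsa hS) η hε
    have h1 : ‖π c η‖ ≤ β * ‖ξ‖ := by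
      have : π c η = Φ (c • z) ξ := by rw [(hΦ c z).1]; rfl
      rw [this]
      exact (Φ (c • z)).le_of_opNorm_le (by rw [Φ.norm_map]; exact hβ c hc) ξ
    have h2 : (inner ℂ (π c η) η).re ≤ β * ‖ξ‖ * ‖η‖ :=
      (Complex.re_le_norm _).trans ((norm_inner_le_norm _ _).trans
        (mul_le_mul_of_nonneg_right h1 (norm_nonneg η)))
    have h3 : (inner ℂ η η).re = ‖η‖ ^ 2 := inner_self_eq_norm_sq (𝕜 := ℂ) η
    rw [map_one, sub_apply, inner_sub_left, Complex.sub_re, one_apply_eq_self, h3] at h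
    linarith
  rcases eq_or_lt_of_le (norm_nonneg η) with h | h
  · rw [← h]; positivity
  · nlinarith

end NotNormal


/-! ### Tensors of constant functions and evaluation at `t₀` -/

namespace AlgTensor

variable {X : Type*} [NormedAddCommGroup X] [NormedSpace ℂ X]
  {Y : Type*} [NormedAddCommGroup Y] [NormedSpace ℂ Y]
  {X' : Type*} [NormedAddCommGroup X'] [NormedSpace ℂ X']
  {Y' : Type*} [NormedAddCommGroup Y'] [NormedSpace ℂ Y']

/-- The tensor product of two linear maps. -/
noncomputable def map (f : X →ₗ[ℂ] X') (g : Y →ₗ[ℂ] Y') : AlgTensor X Y →ₗ[ℂ] AlgTensor X' Y' :=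
  (TensorProduct.map f g : X ⊗[ℂ] Y →ₗ[ℂ] X' ⊗[ℂ] Y')

lemma map_tmul (f : X →ₗ[ℂ] X') (g : Y →ₗ[ℂ] Y') (x : X) (y : Y) :
    map f g (tmul x y) = tmul (f x) (g y) := TensorProduct.map_tmul f g x y

lemma norm_map_apply_le {f : X →ₗ[ℂ] X'} {g : Y →ₗ[ℂ] Y'} (hf : ∀ x, ‖f x‖ ≤ ‖x‖)
    (hg : ∀ y, ‖g y‖ ≤ ‖y‖) (w : AlgTensor X Y) : ‖map f g w‖ ≤ ‖w‖ := by
  have := norm_map_le (map f g).toAddMonoidHom f g zero_le_one (map_tmul f g)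
    (fun x y => by
      rw [one_mul]
      exact mul_le_mul (hf x) (hg y) (norm_nonneg _) (norm_nonneg _)) w
  rwa [one_mul] at this

@[elab_as_elim]
lemma induction_on {p : AlgTensor X Y → Prop} (w : AlgTensor X Y) (zero : p 0)
    (tmul : ∀ x y, p (tmul x y)) (add : ∀ w z, p w → p z → p (w + z)) : p w :=
  TensorProduct.induction_on w zero tmul add

lemma inclusion_eq_map (X₀ : Submodule ℂ X) (w : AlgTensor X₀ Y) :
    inclusion Y X₀ w = map X₀.subtype LinearMap.id w := rfl

lemma norm_inclusion_le (X₀ : Submodule ℂ X) (w : AlgTensor X₀ Y) : ‖inclusion Y X₀ w‖ ≤ ‖w‖ :=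
  norm_map_apply_le (fun _ => le_rfl) (fun _ => le_rfl) w

end AlgTensor

lemma ProjTensor.isometry_inclusion_iff {X : Type v} [NormedAddCommGroup X] [NormedSpace ℂ X]
    (Y : Type w) [NormedAddCommGroup Y] [NormedSpace ℂ Y] (X₀ : Submodule ℂ X) :
    Isometry (ProjTensor.inclusion Y X₀) ↔ ∀ w, ‖w‖ ≤ ‖AlgTensor.inclusion Y X₀ w‖ := by
  have hcoe : ∀ w : AlgTensor X₀ Y, ProjTensor.inclusion Y X₀ (w : ProjTensor X₀ Y) =
      (AlgTensor.inclusion Y X₀ w : AlgTensor X Y) := fun w =>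
    ContinuousLinearMap.completion_apply_coe _ w
  refine ⟨fun h w => ?_, fun h => AddMonoidHomClass.isometry_of_norm _ fun z => ?_⟩
  · have := h.norm_map_of_map_zero (map_zero _) (w : ProjTensor X₀ Y)
    rw [hcoe] at this
    exact ((Completion.norm_coe w).symm.trans this.symm).le.trans (Completion.norm_coe _).le
  · induction z using Completion.induction_on with
    | hp => exact isClosed_eq (ProjTensor.inclusion Y X₀).continuous.norm continuous_norm
    | ih w =>
      rw [hcoe]
      exact (Completion.norm_coe _).trans ((le_antisymm (AlgTensor.norm_inclusion_le X₀ w)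
        (h w)).trans (Completion.norm_coe w).symm)

section Constants

variable {C : Type u} [CommCStarAlgebra C] {U : Type v} [NormedAddCommGroup U] [NormedSpace ℂ U]

variable (C U) in
/-- The embedding of `U` into `C(Δ, U)` as the constant functions. -/
noncomputable def constFun : U →ₗ[ℂ] VecFun C U where
  toFun u := ContinuousMap.const (characterSpace ℂ C) u
  map_add' _ _ := rfl
  map_smul' _ _ := rfl

lemma norm_constFun_le (u : U) : ‖constFun C U u‖ ≤ ‖u‖ :=
  (VecFun.norm_le (norm_nonneg u)).2 fun _ => le_rfl

variable (t₀ : characterSpace ℂ C) (U₀ : Submodule ℂ U)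

/-- The embedding of `U₀` into the pinned functions as the constant functions. -/
noncomputable def constPinned : U₀ →ₗ[ℂ] pinnedFun t₀ U₀ where
  toFun u := ⟨constFun C U u, u.2⟩
  map_add' _ _ := rfl
  map_smul' _ _ := rfl

/-- Multiplication of constant functions by an element that vanishes at `t₀`. -/
noncomputable def mulConst {c : C} (hc : t₀ c = 0) : U →ₗ[ℂ] pinnedFun t₀ U₀ where
  toFun u := ⟨c • constFun C U u, by
    change t₀ c • u ∈ U₀
    rw [hc, zero_smul]
    exact U₀.zero_mem⟩
  map_add' u u' := Subtype.ext (by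
    change c • constFun C U (u + u') = c • constFun C U u + c • constFun C U u'
    rw [map_add, smul_add])
  map_smul' a u := Subtype.ext (by
    change c • constFun C U (a • u) = a • c • constFun C U u
    rw [map_smul, smul_comm])

/-- Evaluation at `t₀`. -/
noncomputable def evalPinned : pinnedFun t₀ U₀ →ₗ[ℂ] U₀ where
  toFun f := ⟨(f : VecFun C U) t₀, f.2⟩
  map_add' _ _ := rfl
  map_smul' _ _ := rfl

/-- Evaluation at `t₀`. -/
noncomputable def evalFun : VecFun C U →ₗ[ℂ] U where
  toFun f := f t₀
  map_add' _ _ := rfl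
  map_smul' _ _ := rfl

lemma norm_evalPinned_le (f : pinnedFun t₀ U₀) : ‖evalPinned t₀ U₀ f‖ ≤ ‖f‖ :=
  VecFun.norm_apply_le (f : VecFun C U) t₀

lemma norm_evalFun_le (f : VecFun C U) : ‖evalFun t₀ f‖ ≤ ‖f‖ := f.norm_apply_le t₀

variable {V : Type w} [NormedAddCommGroup V] [NormedSpace ℂ V]

lemma norm_map_eval_le (w : AlgTensor (pinnedFun t₀ U₀) (VecFun C V)) :
    ‖AlgTensor.map (evalPinned t₀ U₀) (evalFun t₀) w‖ ≤ ‖w‖ :=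
  AlgTensor.norm_map_apply_le (norm_evalPinned_le t₀ U₀) (norm_evalFun_le t₀) w

/-- Evaluation at `t₀`, as a contraction of projective tensor products. -/
noncomputable def evalTensor :
    ProjTensor (pinnedFun t₀ U₀) (VecFun C V) →L[ℂ] ProjTensor U₀ V :=
  ((AlgTensor.map (evalPinned t₀ U₀) (evalFun t₀)).mkContinuous 1 fun w => by
    rw [one_mul]
    exact norm_map_eval_le t₀ U₀ w).completion

lemma evalTensor_coe (w : AlgTensor (pinnedFun t₀ U₀) (VecFun C V)) :
    evalTensor t₀ U₀ (w : ProjTensor (pinnedFun t₀ U₀) (VecFun C V)) =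
      (AlgTensor.map (evalPinned t₀ U₀) (evalFun t₀) w : AlgTensor U₀ V) :=
  ContinuousLinearMap.completion_apply_coe _ w

lemma norm_evalTensor_le (z : ProjTensor (pinnedFun t₀ U₀) (VecFun C V)) :
    ‖evalTensor t₀ U₀ z‖ ≤ ‖z‖ := by
  induction z using Completion.induction_on with
  | hp => exact isClosed_le (evalTensor t₀ U₀).continuous.norm continuous_norm
  | ih w =>
    rw [evalTensor_coe]
    exact (Completion.norm_coe _).trans_le ((norm_map_eval_le t₀ U₀ w).trans
      (Completion.norm_coe w).ge)

/-- At `t₀` both sides of a balancing relation acquire the same scalar `t₀ c`; hence evaluation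
descends to the tensor product over `C`. -/
lemma evalTensor_eq_zero {z : ProjTensor (pinnedFun t₀ U₀) (VecFun C V)}
    (hz : z ∈ balancingSubmodule C (pinnedFun t₀ U₀) (VecFun C V)) : evalTensor t₀ U₀ z = 0 := by
  have hker : IsClosed {z | evalTensor (V := V) t₀ U₀ z = 0} :=
    isClosed_eq (evalTensor t₀ U₀).continuous continuous_const
  refine hker.closure_subset_iff.2 (fun y hy => ?_) hz
  have hy' : y ∈ Submodule.span ℂ (balancingSet C (pinnedFun t₀ U₀) (VecFun C V)) := hy
  refine (Submodule.span_le (p := LinearMap.ker (evalTensor (V := V) t₀ U₀).toLinearMap)).2 ?_ hy'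
  rintro _ ⟨f, c, g, rfl⟩
  change evalTensor t₀ U₀ _ = 0
  rw [evalTensor_coe, map_sub, AlgTensor.map_tmul, AlgTensor.map_tmul]
  have h1 : AlgTensor.tmul (evalPinned t₀ U₀ (c • f)) (evalFun t₀ g) =
      AlgTensor.tmul (evalPinned t₀ U₀ f) (evalFun t₀ (c • g)) :=
    TensorProduct.smul_tmul (R := ℂ) (t₀ c) (evalPinned t₀ U₀ f) (evalFun t₀ g)
  rw [h1, sub_self, Completion.coe_zero]

/-- The element of the module tensor product given by a tensor with constant entries. -/
noncomputable def constTensor (w : AlgTensor U₀ V) :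
    ModTensor C (pinnedFun t₀ U₀) (VecFun C V) :=
  toModTensor C (AlgTensor.map (constPinned t₀ U₀) (constFun C V) w)

lemma map_eval_map_const (w : AlgTensor U₀ V) :
    AlgTensor.map (evalPinned t₀ U₀) (evalFun t₀)
      (AlgTensor.map (constPinned t₀ U₀) (constFun C V) w) = w := by
  induction w using AlgTensor.induction_on with
  | zero => rw [map_zero, map_zero]
  | tmul u v => rw [AlgTensor.map_tmul, AlgTensor.map_tmul]; rfl
  | add w z hw hz => rw [map_add, map_add, hw, hz]

/-- Evaluation at `t₀` is a contractive left inverse of the embedding by constants. -/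
lemma le_norm_constTensor (w : AlgTensor U₀ V) : ‖w‖ ≤ ‖constTensor t₀ U₀ w‖ := by
  refine le_of_forall_pos_le_add fun ε hε => ?_
  obtain ⟨m, hm, hlt⟩ := Submodule.Quotient.norm_mk_lt (constTensor t₀ U₀ w) hε
  have h1 := evalTensor_eq_zero t₀ U₀ ((Submodule.Quotient.eq _).1 hm)
  rw [map_sub, sub_eq_zero, evalTensor_coe] at h1
  rw [map_eval_map_const] at h1
  calc ‖w‖ = ‖(w : ProjTensor U₀ V)‖ := (Completion.norm_coe w).symm
    _ = ‖evalTensor t₀ U₀ m‖ := by rw [h1]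
    _ ≤ ‖m‖ := norm_evalTensor_le t₀ U₀ m
    _ ≤ _ := hlt.le

/-- Since `c` vanishes at `t₀`, the function `c u` is pinned for every `u ∈ U`, not only for `u ∈
U₀`. So `w ↦ c w` factors contractively through `U ⊗ V`. -/
lemma norm_smul_constTensor_le {c : C} (hc : t₀ c = 0) (hc1 : ‖c‖ ≤ 1) (w : AlgTensor U₀ V) :
    ‖c • constTensor t₀ U₀ w‖ ≤ ‖AlgTensor.inclusion V U₀ w‖ := by
  have h : c • constTensor t₀ U₀ w = toModTensor C
      (AlgTensor.map (mulConst t₀ U₀ hc) (constFun C V) (AlgTensor.inclusion V U₀ w)) := by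
    rw [AlgTensor.inclusion_eq_map, constTensor]
    induction w using AlgTensor.induction_on with
    | zero => simp
    | tmul u v =>
      rw [AlgTensor.map_tmul, AlgTensor.map_tmul, AlgTensor.map_tmul]
      exact (smul_modTmul c (constPinned t₀ U₀ u) (constFun C V v)).symm
    | add w z hw hz => rw [map_add, map_add, smul_add, hw, hz, map_add, map_add, map_add]
  rw [h]
  refine (norm_toModTensor_le _).trans (AlgTensor.norm_map_apply_le (fun u => ?_)
    (fun v => norm_constFun_le v) _)
  refine (norm_smul_le c (constFun C U u)).trans ?_
  exact (mul_le_mul hc1 (norm_constFun_le u) (norm_nonneg _) zero_le_one).trans_eq (one_mul _)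

end Constants

section NotNormal

variable {H : Type u} [NormedAddCommGroup H] [InnerProductSpace ℂ H] [CompleteSpace H]
  {M : VonNeumannAlgebra H} [IsMulCommutative M] {U : Type v} [NormedAddCommGroup U]
  [NormedSpace ℂ U] {V : Type w} [NormedAddCommGroup V] [NormedSpace ℂ V]

lemma not_isCNRM_modTensor {t₀ : characterSpace ℂ M}
    (ht₀ : ¬ IsOpen ({t₀} : Set (characterSpace ℂ M))) {U₀ : Submodule ℂ U}
    (hU₀ : ¬ Isometry (ProjTensor.inclusion V U₀)) :
    ¬ IsCNRM M (ModTensor M (pinnedFun t₀ U₀) (VecFun M V)) := by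
  intro h
  refine hU₀ ((ProjTensor.isometry_inclusion_iff V U₀).2 fun w =>
    (le_norm_constTensor t₀ U₀ w).trans ?_)
  refine h.norm_le ⟨0, zero_mem_vanishingContractions t₀⟩ (directedOn_vanishingContractions t₀)
    (fun c hc => ext_char fun t => ?_)
    (fun c d hcd => exists_star_mul_self_of_char (char_of_le hcd))
    (isLUB_vanishingContractions ht₀)
    (fun c hc => norm_smul_constTensor_le t₀ U₀ hc.2 (norm_le_of_char zero_le_one fun t => ?_) w)
  · obtain ⟨r, -, -, hr⟩ := hc.1 t
    rw [map_star, hr, RCLike.star_def, Complex.conj_ofReal]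
  · obtain ⟨r, h0, h1, hr⟩ := hc.1 t
    rwa [hr, Complex.norm_real, Real.norm_of_nonneg h0]

end NotNormal


/-! ### A non-isometric inclusion of projective tensor products -/

section Example

/-- The space `ℓ¹` in dimension three. -/
abbrev EllOne : Type := PiLp 1 fun _ : Fin 3 => ℂ

lemma norm_ellOne (x : EllOne) : ‖x‖ = ‖x 0‖ + ‖x 1‖ + ‖x 2‖ := by
  rw [PiLp.norm_eq_of_L1, Fin.sum_univ_three]

/-- The subspace of vectors with sum zero. -/
def sumZero : Submodule ℂ EllOne where
  carrier := {x | x 0 + x 1 + x 2 = 0}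
  add_mem' {x y} hx hy := by
    change x 0 + y 0 + (x 1 + y 1) + (x 2 + y 2) = 0
    change x 0 + x 1 + x 2 = 0 at hx
    change y 0 + y 1 + y 2 = 0 at hy
    linear_combination hx + hy
  zero_mem' := by simp
  smul_mem' a x hx := by
    change a * x 0 + a * x 1 + a * x 2 = 0
    change x 0 + x 1 + x 2 = 0 at hx
    linear_combination a * hx

/-- Each coordinate is minus the sum of the other two, so twice its modulus is at most the `ℓ¹`
norm. The factor `1 / 2` is the gain over the coordinate functionals on all of `ℓ¹`. -/
lemma norm_coord_le (x : sumZero) (i : Fin 3) : ‖(x : EllOne) i‖ ≤ 1 / 2 * ‖x‖ := by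
  have hx : (x : EllOne) 0 + (x : EllOne) 1 + (x : EllOne) 2 = 0 := x.2
  have hn : ‖x‖ = _ := norm_ellOne x
  rw [hn]
  have key : ∀ a b c : ℂ, a + b + c = 0 → ‖a‖ ≤ ‖b‖ + ‖c‖ := fun a b c h => by
    have : a = -(b + c) := by linear_combination h
    rw [this, norm_neg]
    exact norm_add_le _ _
  fin_cases i
  · have := key _ _ _ hx
    simp only [Fin.zero_eta]; linarith
  · have := key ((x : EllOne) 1) ((x : EllOne) 0) ((x : EllOne) 2) (by linear_combination hx)
    simp only [Fin.mk_one]; linarith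
  · have := key ((x : EllOne) 2) ((x : EllOne) 0) ((x : EllOne) 1) (by linear_combination hx)
    simp only [Fin.reduceFinMk]; linarith

/-- The coordinate functionals on `sumZero`. -/
noncomputable def coordDual (i : Fin 3) : StrongDual ℂ sumZero :=
  LinearMap.mkContinuous
    { toFun := fun x => (x : EllOne) i
      map_add' := fun _ _ => rfl
      map_smul' := fun _ _ => rfl } (1 / 2) fun x => norm_coord_le x i

lemma norm_coordDual_le (i : Fin 3) : ‖coordDual i‖ ≤ 1 / 2 :=
  LinearMap.mkContinuous_norm_le _ (by norm_num) _

/-- The standard basis vectors. -/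
noncomputable def basisVec (i : Fin 3) : EllOne := PiLp.single 1 i 1

lemma norm_basisVec (i : Fin 3) : ‖basisVec i‖ = 1 := by
  rw [basisVec, PiLp.norm_single, norm_one]

lemma sub_mem_sumZero (i : Fin 3) : basisVec i - basisVec 2 ∈ sumZero := by
  change (basisVec i - basisVec 2) 0 + (basisVec i - basisVec 2) 1 + (basisVec i - basisVec 2) 2 = 0
  fin_cases i <;> simp [basisVec]

/-- The pairing of a space with its dual, as a functional on the tensor product. -/
noncomputable def pairing (X : Type v) [NormedAddCommGroup X] [NormedSpace ℂ X] :
    AlgTensor X (StrongDual ℂ X) →ₗ[ℂ] ℂ :=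
  (TensorProduct.lift ((ContinuousLinearMap.coeLM ℂ).flip :
    X →ₗ[ℂ] StrongDual ℂ X →ₗ[ℂ] ℂ) : X ⊗[ℂ] StrongDual ℂ X →ₗ[ℂ] ℂ)

lemma pairing_tmul {X : Type v} [NormedAddCommGroup X] [NormedSpace ℂ X] (x : X)
    (φ : StrongDual ℂ X) : pairing X (AlgTensor.tmul x φ) = φ x := rfl

lemma norm_pairing_le {X : Type v} [NormedAddCommGroup X] [NormedSpace ℂ X]
    (w : AlgTensor X (StrongDual ℂ X)) : ‖pairing X w‖ ≤ ‖w‖ := by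
  refine le_csInf (AlgTensor.costs_nonempty w) ?_
  rintro _ ⟨n, x, φ, rfl, rfl⟩
  rw [map_sum]
  exact norm_sum_le_of_le _ fun j _ => by
    rw [pairing_tmul, mul_comm]
    exact (φ j).le_opNorm _

/-- The tensor `w` represents the identity of the two-dimensional space `sumZero`. Its trace is `2`,
so its norm there is at least `2`; in `ℓ¹` it equals `∑ eᵢ ⊗ xᵢ`, of cost at most `3 / 2`. -/
lemma not_isometry_inclusion_sumZero :
    ¬ Isometry (ProjTensor.inclusion (StrongDual ℂ sumZero) sumZero) := by
  rw [ProjTensor.isometry_inclusion_iff]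
  intro h
  let w : AlgTensor sumZero (StrongDual ℂ sumZero) :=
    AlgTensor.tmul ⟨_, sub_mem_sumZero 0⟩ (coordDual 0) +
      AlgTensor.tmul ⟨_, sub_mem_sumZero 1⟩ (coordDual 1)
  have hlow : 2 ≤ ‖w‖ := by
    have h1 : pairing sumZero w = 2 := by
      rw [map_add, pairing_tmul, pairing_tmul]
      change (basisVec 0 - basisVec 2) 0 + (basisVec 1 - basisVec 2) 1 = 2
      simp [basisVec]
      norm_num
    have h2 := norm_pairing_le w
    rwa [h1, Complex.norm_ofNat] at h2
  have hsum : coordDual 2 = -coordDual 0 - coordDual 1 := by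
    ext x
    have hx : (x : EllOne) 0 + (x : EllOne) 1 + (x : EllOne) 2 = 0 := x.2
    change (x : EllOne) 2 = -(x : EllOne) 0 - (x : EllOne) 1
    linear_combination hx
  have hincl : AlgTensor.inclusion (StrongDual ℂ sumZero) sumZero w =
      AlgTensor.tmul (basisVec 0) (coordDual 0) + AlgTensor.tmul (basisVec 1) (coordDual 1) +
        AlgTensor.tmul (basisVec 2) (coordDual 2) := by
    rw [AlgTensor.inclusion_eq_map, map_add, AlgTensor.map_tmul, AlgTensor.map_tmul, hsum]
    change (basisVec 0 - basisVec 2) ⊗ₜ[ℂ] coordDual 0 + (basisVec 1 - basisVec 2) ⊗ₜ[ℂ] coordDual 1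
      = basisVec 0 ⊗ₜ[ℂ] coordDual 0 + basisVec 1 ⊗ₜ[ℂ] coordDual 1 +
        basisVec 2 ⊗ₜ[ℂ] (-coordDual 0 - coordDual 1)
    rw [TensorProduct.sub_tmul, TensorProduct.sub_tmul, TensorProduct.tmul_sub,
      TensorProduct.tmul_neg]
    abel
  have hterm : ∀ i, ‖AlgTensor.tmul (basisVec i) (coordDual i)‖ ≤ 1 / 2 := fun i =>
    (AlgTensor.norm_le_of_mem (AlgTensor.tmul_mem_costs _ _)).trans (by
      rw [norm_basisVec, one_mul]; exact norm_coordDual_le i)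
  have hup := (h w).trans_eq (congrArg norm hincl)
  have h1 := hlow.trans (hup.trans ((norm_add_le _ _).trans (add_le_add
    ((norm_add_le _ _).trans (add_le_add (hterm 0) (hterm 1))) (hterm 2))))
  norm_num at h1

end Example

/-! ### An infinite-dimensional abelian algebra and non-isolated points -/

section Diagonal

variable (ι : Type u) [DecidableEq ι]

/-- The rank one projections onto the coordinates of `ℓ²(ι)`. -/
noncomputable def coordProj (i : ι) : lp (fun _ : ι => ℂ) 2 →L[ℂ] lp (fun _ : ι => ℂ) 2 :=
  diagOp (fun j => if j = i then 1 else 0) zero_le_one fun j => by split_ifs <;> simp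

variable {ι}

lemma coordProj_apply (i j : ι) (x : lp (fun _ : ι => ℂ) 2) :
    coordProj ι i x j = if j = i then x j else 0 := by
  rw [coordProj, diagOp_apply]
  split_ifs <;> simp

lemma coordProj_eq_single (i : ι) (x : lp (fun _ : ι => ℂ) 2) :
    coordProj ι i x = lp.single 2 i (x i) := by
  refine lp.ext (funext fun j => ?_)
  rw [coordProj_apply]
  rcases eq_or_ne j i with rfl | h
  · simp
  · rw [if_neg h, lp.single_apply_ne _ _ _ h]

lemma coordProj_mul_comm (i j : ι) : coordProj ι i * coordProj ι j = coordProj ι j * coordProj ι i := by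
  refine ContinuousLinearMap.ext fun x => lp.ext (funext fun k => ?_)
  simp only [mul_apply_eq_comp, coordProj_apply]
  split_ifs <;> rfl

variable (ι) in
/-- The diagonal operators on `ℓ²(ι)`. -/
noncomputable def diagonalAlgebra : VonNeumannAlgebra (lp (fun _ : ι => ℂ) 2) where
  toStarSubalgebra := StarSubalgebra.centralizer ℂ (Set.range (coordProj ι))
  centralizer_centralizer' := by
    change Set.centralizer (Set.centralizer
      (↑(StarSubalgebra.centralizer ℂ (Set.range (coordProj ι))) :
        Set (lp (fun _ : ι => ℂ) 2 →L[ℂ] lp (fun _ : ι => ℂ) 2))) =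
      (↑(StarSubalgebra.centralizer ℂ (Set.range (coordProj ι))) :
        Set (lp (fun _ : ι => ℂ) 2 →L[ℂ] lp (fun _ : ι => ℂ) 2))
    rw [StarSubalgebra.coe_centralizer]
    exact Set.centralizer_centralizer_centralizer _

lemma star_coordProj (i : ι) : star (coordProj ι i) = coordProj ι i := by
  rw [ContinuousLinearMap.star_eq_adjoint, eq_comm, ContinuousLinearMap.eq_adjoint_iff]
  intro x y
  rw [coordProj_eq_single, coordProj_eq_single, lp.inner_single_left, lp.inner_single_right]

lemma mem_diagonalAlgebra {T : lp (fun _ : ι => ℂ) 2 →L[ℂ] lp (fun _ : ι => ℂ) 2} :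
    T ∈ diagonalAlgebra ι ↔ ∀ i, coordProj ι i * T = T * coordProj ι i := by
  change T ∈ StarSubalgebra.centralizer ℂ (Set.range (coordProj ι)) ↔ _
  rw [StarSubalgebra.mem_centralizer_iff]
  simp only [Set.forall_mem_range, star_coordProj, and_self]

lemma coordProj_mem (i : ι) : coordProj ι i ∈ diagonalAlgebra ι :=
  mem_diagonalAlgebra.2 fun j => coordProj_mul_comm j i

/-- Commuting with the rank one projection onto a coordinate line forces `T` to preserve that line.
-/
lemma exists_apply_single_eq_smul {T : lp (fun _ : ι => ℂ) 2 →L[ℂ] lp (fun _ : ι => ℂ) 2}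
    (hT : T ∈ diagonalAlgebra ι) (i : ι) :
    ∃ τ : ℂ, ∀ c, T (lp.single 2 i c) = τ • lp.single (E := fun _ : ι => ℂ) 2 i c := by
  have hsingle : ∀ c : ℂ, lp.single (E := fun _ : ι => ℂ) 2 i c =
      c • lp.single (E := fun _ : ι => ℂ) 2 i 1 := fun c => by
    rw [← lp.single_smul, smul_eq_mul, mul_one]
  have h1 := congrArg (fun S => S (lp.single 2 i 1)) (mem_diagonalAlgebra.1 hT i)
  simp only [mul_apply_eq_comp, coordProj_eq_single, lp.single_apply_self] at h1
  rw [hsingle] at h1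
  refine ⟨T (lp.single 2 i 1) i, fun c => ?_⟩
  rw [hsingle c, map_smul, smul_comm, h1]

instance : IsMulCommutative (diagonalAlgebra ι) where
  is_comm.comm := fun ⟨S, hS⟩ ⟨T, hT⟩ => Subtype.ext <| by
    refine lp.ext_continuousLinearMap (by norm_num) fun i => ContinuousLinearMap.ext fun c => ?_
    obtain ⟨σ, hσ⟩ := exists_apply_single_eq_smul hS i
    obtain ⟨τ, hτ⟩ := exists_apply_single_eq_smul hT i
    change S (T (lp.single 2 i c)) = T (S (lp.single 2 i c))
    rw [hσ, hτ, map_smul, map_smul, hσ, hτ, smul_comm]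

lemma not_finiteDimensional_diagonalAlgebra [Infinite ι] :
    ¬ FiniteDimensional ℂ (diagonalAlgebra ι) := by
  intro _
  have hli : LinearIndependent ℂ fun i : ι => (⟨coordProj ι i, coordProj_mem i⟩ :
      diagonalAlgebra ι) := by
    rw [linearIndependent_iff']
    intro s g hg i hi
    have h1 : ∑ j ∈ s, g j • coordProj ι j = 0 := by
      have := congrArg Subtype.val hg
      simpa using this
    have h2 := congrArg (fun T : lp (fun _ : ι => ℂ) 2 →L[ℂ] lp (fun _ : ι => ℂ) 2 =>
      (T (lp.single 2 i 1) : ι → ℂ) i) h1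
    simp only [sum_apply, smul_apply, lp.coeFn_sum, Finset.sum_apply, lp.coeFn_smul, Pi.smul_apply,
      coordProj_apply, lp.single_apply_self] at h2
    simpa [hi] using h2
  exact not_finite_iff_infinite.2 ‹Infinite ι› hli.finite

end Diagonal

/-- If every point were isolated, the compact spectrum would be finite and `C` would embed into a
finite-dimensional function space. -/
lemma exists_nonisolated_character {C : Type u} [CommCStarAlgebra C]
    (hC : ¬ FiniteDimensional ℂ C) :
    ∃ t₀ : characterSpace ℂ C, ¬ IsOpen ({t₀} : Set (characterSpace ℂ C)) := by
  by_contra! h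
  have : DiscreteTopology (characterSpace ℂ C) := discreteTopology_iff_isOpen_singleton.2 h
  have : Finite (characterSpace ℂ C) := finite_of_compact_of_discrete
  let f : C →ₗ[ℂ] (characterSpace ℂ C → ℂ) :=
    { toFun := fun c t => t c
      map_add' := fun c d => funext fun t => map_add t c d
      map_smul' := fun a c => funext fun t => map_smul t a c }
  exact hC (FiniteDimensional.of_injective f fun c d h => ext_char (congrFun h))

lemma pinnedFun_vecFun_spec {H : Type u} [NormedAddCommGroup H] [InnerProductSpace ℂ H]
    [CompleteSpace H] (M : VonNeumannAlgebra H) [IsMulCommutative M]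
    (t₀ : characterSpace ℂ M) (ht₀ : ¬ IsOpen ({t₀} : Set (characterSpace ℂ M)))
    (U : Type v) [NormedAddCommGroup U] [NormedSpace ℂ U] [CompleteSpace U] (U₀ : Submodule ℂ U)
    (hU₀ : IsClosed (U₀ : Set U)) (V : Type w) [NormedAddCommGroup V] [NormedSpace ℂ V]
    [CompleteSpace V] (hV : ¬ Isometry (ProjTensor.inclusion V U₀)) :
    IsCNRM M (pinnedFun t₀ U₀) ∧ IsCNRM M (VecFun M V) ∧
      IsCRM M (ModTensor M (pinnedFun t₀ U₀) (VecFun M V)) ∧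
      ¬ IsCNRM M (ModTensor M (pinnedFun t₀ U₀) (VecFun M V)) :=
  ⟨isCNRM_pinnedFun t₀ hU₀, isCNRM_vecFun,
    isCRM_modTensor (isModuleConvex_pinnedFun t₀ U₀) isModuleConvex_vecFun,
    not_isCNRM_modTensor ht₀ hV⟩

end CentralModule

theorem mainTheorem6 :
    -- infinite-dimensional abelian von Neumann algebras `M` exist, and over each of them
    -- there are modules `X`, `Y` in `CNRM` with `X ⊗ Y` representable, but not normal
    ((∃ (H : Type u) (_ : NormedAddCommGroup H) (_ : InnerProductSpace ℂ H)
        (_ : CompleteSpace H) (M : VonNeumannAlgebra H),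
        IsMulCommutative M ∧ ¬ FiniteDimensional ℂ M) ∧
      ∀ (H : Type u) [NormedAddCommGroup H] [InnerProductSpace ℂ H] [CompleteSpace H]
        (M : VonNeumannAlgebra H) [IsMulCommutative M], ¬ FiniteDimensional ℂ M →
        ∃ (X : Type u) (_ : NormedAddCommGroup X) (_ : NormedSpace ℂ X) (_ : Module M X)
          (_ : IsScalarTower ℂ M X) (_ : IsBoundedSMul M X)
          (Y : Type u) (_ : NormedAddCommGroup Y) (_ : NormedSpace ℂ Y) (_ : Module M Y)
          (_ : IsScalarTower ℂ M Y) (_ : IsBoundedSMul M Y),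
          CentralModule.IsCNRM M X ∧ CentralModule.IsCNRM M Y ∧
          CentralModule.IsCRM M (CentralModule.ModTensor M X Y) ∧
          ¬ CentralModule.IsCNRM M (CentralModule.ModTensor M X Y)) ∧
    -- there are Banach spaces `U₀ ⊆ U` and `V` with `U₀ ⊗ V → U ⊗ V` not isometric, and all of
    -- them give such modules over `M`, for each non-isolated point `t₀` of the spectrum of `M`
    ((∃ (U : Type) (_ : NormedAddCommGroup U) (_ : NormedSpace ℂ U) (_ : CompleteSpace U)
        (U₀ : Submodule ℂ U) (_ : IsClosed (U₀ : Set U))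
        (V : Type) (_ : NormedAddCommGroup V) (_ : NormedSpace ℂ V) (_ : CompleteSpace V),
        ¬ Isometry (CentralModule.ProjTensor.inclusion V U₀)) ∧
      ∀ (H : Type u) [NormedAddCommGroup H] [InnerProductSpace ℂ H] [CompleteSpace H]
        (M : VonNeumannAlgebra H) [IsMulCommutative M]
        (t₀ : WeakDual.characterSpace ℂ M), ¬ IsOpen ({t₀} : Set (WeakDual.characterSpace ℂ M)) →
        ∀ (U : Type v) [NormedAddCommGroup U] [NormedSpace ℂ U] [CompleteSpace U]
          (U₀ : Submodule ℂ U), IsClosed (U₀ : Set U) →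
        ∀ (V : Type w) [NormedAddCommGroup V] [NormedSpace ℂ V] [CompleteSpace V],
          ¬ Isometry (CentralModule.ProjTensor.inclusion V U₀) →
          CentralModule.IsCNRM M (CentralModule.pinnedFun t₀ U₀) ∧
          CentralModule.IsCNRM M (CentralModule.VecFun M V) ∧
          CentralModule.IsCRM M
            (CentralModule.ModTensor M (CentralModule.pinnedFun t₀ U₀)
              (CentralModule.VecFun M V)) ∧
          ¬ CentralModule.IsCNRM M
            (CentralModule.ModTensor M (CentralModule.pinnedFun t₀ U₀)
              (CentralModule.VecFun M V))) := by
  classical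
  -- The lifted index set places `ℓ²` in the prescribed universe.
  refine ⟨⟨⟨lp (fun _ : ULift.{u} ℕ => ℂ) 2, inferInstance, inferInstance, inferInstance,
    CentralModule.diagonalAlgebra _, inferInstance,
    CentralModule.not_finiteDimensional_diagonalAlgebra⟩, ?_⟩,
    ⟨CentralModule.EllOne, inferInstance, inferInstance, inferInstance, CentralModule.sumZero,
      Submodule.closed_of_finiteDimensional _, StrongDual ℂ CentralModule.sumZero, inferInstance,
      inferInstance, inferInstance, CentralModule.not_isometry_inclusion_sumZero⟩, ?_⟩
  · intro H _ _ _ M _ hM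
    obtain ⟨t₀, ht₀⟩ := CentralModule.exists_nonisolated_character hM
    exact ⟨_, _, _, _, _, _, _, _, _, _, _, _, CentralModule.pinnedFun_vecFun_spec M t₀ ht₀
      CentralModule.EllOne CentralModule.sumZero (Submodule.closed_of_finiteDimensional _)
      (StrongDual ℂ CentralModule.sumZero) CentralModule.not_isometry_inclusion_sumZero⟩
  · intro H _ _ _ M _ t₀ ht₀ U _ _ _ U₀ hU₀ V _ _ _ hV
    exact CentralModule.pinnedFun_vecFun_spec M t₀ ht₀ U U₀ hU₀ V hV
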